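/- An index is a finite (possibly empty) tuple $\mathbf{k}=(k_1,\dots,k_r)$ of positive integers, with weight $\mathrm{wt}(\mathbf{k})=k_1+\cdots+k_r$; it is admissible if it is empty or $k_r\ge 2$. For admissible $\mathbf{k}$ put $\zeta(\mathbf{k})=\sum_{0<n_1<\cdots<n_r}n_1^{-k_1}\cdots n_r^{-k_r}$, with $\zeta(\varnothing)=1$. Let $\mathfrak{H}=\mathbb{Q}\langle x,y\rangle$, $\mathfrak{H}^1=\mathbb{Q}+y\mathfrak{H}$, $z_k=yx^{k-1}$ and $z_{\mathbf{k}}=z_{k_1}\cdots z_{k_r}$. The harmonic product $*$ on $\mathfrak{H}^1$ and the shuffle product $\mathrm{sh}$ on $\mathfrak{H}$ (under which $\mathfrak{H}^1$ is closed) are the $\mathbb{Q}$-bilinear products with unit $1$ given by $$w_1z_a*w_2z_b=(w_1*w_2z_b)z_a+(w_1z_a*w_2)z_b+(w_1*w_2)z_{a+b},$$ $$w_1u\mathbin{\mathrm{sh}}w_2v=(w_1\mathbin{\mathrm{sh}}w_2v)u+(w_1u\mathbin{\mathrm{sh}}w_2)v\qquad(u,v\in\{x,y\}).$$ Let $\bullet\in\{*,\mathrm{sh}\}$.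 Then there is a unique $\mathbb{Q}$-linear map $Z^\bullet:\mathfrak{H}^1\to\mathbb{R}[T]$ with $Z^\bullet(w\bullet w')=Z^\bullet(w)Z^\bullet(w')$ for all $w,w'$, with $Z^\bullet(z_{\mathbf{k}})=\zeta(\mathbf{k})$ for all admissible $\mathbf{k}$, and with $Z^\bullet(y)=T$. The regularized value $\zeta^\bullet(\mathbf{k})$ is the constant term of $Z^\bullet(z_{\mathbf{k}})$. For an index $\mathbf{k}=(k_1,\dots,k_r)$ and $0\le i\le r$ write $\mathbf{k}_{[i]}=(k_1,\dots,k_i)$ and $\mathbf{k}^{[i]}=(k_{i+1},\dots,k_r)$, let $\overline{\mathbf{k}}$ be the reversed index, and let $b\binom{\mathbf{k}}{\mathbf{l}}=\prod_j\binom{k_j+l_j-1}{l_j}$ for a tuple $\mathbf{l}$ of non-negative integers of the same length. Define $$\zeta^\bullet_{\widehat{\mathcal S}}(\mathbf{k})=\sum_{i=0}^r(-1)^{\mathrm{wt}(\mathbf{k}^{[i]})}\zeta^\bullet(\mathbf{k}_{[i]})\sum_{\mathbf{l}\in\mathbb{Z}_{\ge0}^{r-i}}b\binom{\mathbf{k}^{[i]}}{\mathbf{l}}\,\zeta^\bullet\bigl(\overline{\mathbf{k}^{[i]}+\mathbf{l}}\bigr)\,t^{\mathrm{wt}(\mathbf{l})}\in\mathbb{R}[[t]]$$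 and, for a positive integer $M$, $$\zeta^\bullet_{\widehat{\mathcal S},M}(\mathbf{k})=\sum_{i=0}^r\ \sum_{(n_1,\dots,n_r)}\frac{1}{n_1^{k_1}\cdots n_i^{k_i}(n_{i+1}+t)^{k_{i+1}}\cdots(n_r+t)^{k_r}}\in\mathbb{Q}[[t]],$$ where the inner sum is over integers with $0<n_1<\cdots<n_i$, $n_{i+1}<\cdots<n_r<0$ and, in addition, with all $|n_j|<M$ if $\bullet=*$, and with $n_i-n_{i+1}<M$ (where $n_0=n_{r+1}=0$) if $\bullet=\mathrm{sh}$. **Theorem.** For every index $\mathbf{k}$ and $\bullet\in\{*,\mathrm{sh}\}$, the map $Z^\bullet$ above exists and is unique, and $$\lim_{M\to\infty}\zeta^\bullet_{\widehat{\mathcal S},M}(\mathbf{k})=\zeta^\bullet_{\widehat{\mathcal S}}(\mathbf{k}),$$ coefficientwise as power series in $t$. -/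

import Mathlib

noncomputable section

namespace TAdicSMZV

open Polynomial PowerSeries

/-! ### Indices and multiple zeta values

An index `(k₁, …, k_r)` is a finite list of positive integers; the empty list is the empty index. -/

/-- An index is admissible if it is empty or its last entry is at least `2`. -/
def Admissible (k : List ℕ+) : Prop := ∀ a ∈ k.getLast?, 2 ≤ a

/-- The weight of an index. -/
def wt (k : List ℕ+) : ℕ := (k.map (fun a => (a : ℕ))).sum

/-- The multiple zeta value `ζ(k) = ∑_{0 < n₁ < ⋯ < n_r} 1 / (n₁ ^ k₁ ⋯ n_r ^ k_r)`
(used for admissible `k`; for the empty index the sum has one term, equal to `1`). -/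
def mzv (k : List ℕ+) : ℝ :=
  ∑' n : {n : Fin k.length → ℕ // StrictMono n ∧ ∀ j, 0 < n j},
    ∏ j, 1 / (n.1 j : ℝ) ^ (k.get j : ℕ)

/-! ### The non-commutative polynomial rings `𝔥 = ℚ⟨x, y⟩` and `𝔥¹` -/

/-- The two letters. -/
inductive Letter
  | x
  | y

/-- `𝔥 = ℚ⟨x, y⟩`. -/
abbrev H : Type := FreeAlgebra ℚ Letter

/-- `𝔥¹`, as the free algebra on the symbols `z_k`, `k ≥ 1`. It is the subalgebra `ℚ + y𝔥` of `𝔥`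
via the embedding `H1.toH : z_k ↦ y x^(k-1)` below. -/
abbrev H1 : Type := FreeAlgebra ℚ ℕ+

/-- The monomial in `𝔥` given by a word in `x, y`. -/
def H.word (w : List Letter) : H := (w.map (FreeAlgebra.ι ℚ)).prod

/-- The monomial `z_k = z_{k₁} ⋯ z_{k_r}` in `𝔥¹`. -/
def H1.z (k : List ℕ+) : H1 := (k.map (FreeAlgebra.ι ℚ)).prod

/-- The words form a basis of `𝔥`. -/
def H.basis : Module.Basis (List Letter) ℚ H := FreeAlgebra.basisFreeMonoid ℚ Letter

/-- The monomials `z_k` form a basis of `𝔥¹`. -/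
def H1.basis : Module.Basis (List ℕ+) ℚ H1 := FreeAlgebra.basisFreeMonoid ℚ ℕ+

theorem basisFreeMonoid_apply {α : Type} (w : FreeMonoid α) :
    FreeAlgebra.basisFreeMonoid ℚ α w = FreeMonoid.lift (FreeAlgebra.ι ℚ) w := by
  have h : FreeAlgebra.basisFreeMonoid ℚ α w =
      MonoidAlgebra.lift ℚ (FreeAlgebra ℚ α) (FreeMonoid α) (FreeMonoid.lift (FreeAlgebra.ι ℚ))
        (MonoidAlgebra.single w 1) := by
    simp only [FreeAlgebra.basisFreeMonoid, Module.Basis.map_apply, Finsupp.coe_basisSingleOne]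
    rfl
  rw [h, MonoidAlgebra.lift_single, one_smul]

theorem H.basis_apply (w : List Letter) : H.basis w = H.word w :=
  (basisFreeMonoid_apply (FreeMonoid.ofList w)).trans (FreeMonoid.lift_ofList _ _)

theorem H1.basis_apply (k : List ℕ+) : H1.basis k = H1.z k :=
  (basisFreeMonoid_apply (FreeMonoid.ofList k)).trans (FreeMonoid.lift_ofList _ _)

/-- The embedding `𝔥¹ → 𝔥`, `z_k ↦ y x^(k-1)`. -/
def H1.toH : H1 →ₐ[ℚ] H :=
  FreeAlgebra.lift ℚ fun k =>
    FreeAlgebra.ι ℚ Letter.y * FreeAlgebra.ι ℚ Letter.x ^ ((k : ℕ) - 1)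

/-- Reads a word as `x^a z_{k₁} ⋯ z_{k_r}` and returns `(a, (k₁, …, k_r))`. -/
def decode : List Letter → ℕ × List ℕ+
  | [] => (0, [])
  | Letter.x :: w => ((decode w).1 + 1, (decode w).2)
  | Letter.y :: w => (0, Nat.succPNat (decode w).1 :: (decode w).2)

/-- A linear map `𝔥 → 𝔥¹` which restricts to the inverse of `H1.toH` on the image of `𝔥¹`. -/
def H.toH1 : H →ₗ[ℚ] H1 := H.basis.constr ℚ fun w => H1.z (decode w).2

/-! ### The harmonic product and the shuffle product -/

/-- The harmonic product of two monomials, whose indices are given in reversed order: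
`w * 1 = 1 * w = w` and
`w₁ z_a * w₂ z_b = (w₁ * w₂ z_b) z_a + (w₁ z_a * w₂) z_b + (w₁ * w₂) z_{a+b}`. -/
def harmonicRev : List ℕ+ → List ℕ+ → H1
  | [], l => H1.z l.reverse
  | a :: k, [] => H1.z (a :: k).reverse
  | a :: k, b :: l =>
      harmonicRev k (b :: l) * FreeAlgebra.ι ℚ a + harmonicRev (a :: k) l * FreeAlgebra.ι ℚ b
        + harmonicRev k l * FreeAlgebra.ι ℚ (a + b)
  termination_by k l => k.length + l.length

/-- The shuffle product of two words, given in reversed order: `w ш 1 = 1 ш w = w` and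
`w₁ a ш w₂ b = (w₁ ш w₂ b) a + (w₁ a ш w₂) b` for letters `a, b`. -/
def shuffleRev : List Letter → List Letter → H
  | [], v => H.word v.reverse
  | a :: u, [] => H.word (a :: u).reverse
  | a :: u, b :: v =>
      shuffleRev u (b :: v) * FreeAlgebra.ι ℚ a + shuffleRev (a :: u) v * FreeAlgebra.ι ℚ b
  termination_by u v => u.length + v.length

/-- The harmonic product on `𝔥¹`. -/
def harmonic : H1 →ₗ[ℚ] H1 →ₗ[ℚ] H1 :=
  H1.basis.constr ℚ fun k => H1.basis.constr ℚ fun l => harmonicRev k.reverse l.reverse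

/-- The shuffle product on `𝔥`. -/
def shuffleH : H →ₗ[ℚ] H →ₗ[ℚ] H :=
  H.basis.constr ℚ fun u => H.basis.constr ℚ fun v => shuffleRev u.reverse v.reverse

/-- The shuffle product on `𝔥¹`, i.e. the restriction of the one on `𝔥`
(see `toH_shuffle`). -/
def shuffle : H1 →ₗ[ℚ] H1 →ₗ[ℚ] H1 :=
  (shuffleH.compl₁₂ H1.toH.toLinearMap H1.toH.toLinearMap).compr₂ H.toH1

theorem H.toH1_word (w : List Letter) : H.toH1 (H.word w) = H1.z (decode w).2 := by
  rw [← H.basis_apply, H.toH1, Module.Basis.constr_basis]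

/-- The word of `𝔥` corresponding to `z_k`. -/
def encode : List ℕ+ → List Letter
  | [] => []
  | a :: k => Letter.y :: (List.replicate ((a : ℕ) - 1) Letter.x ++ encode k)

theorem toH_z (k : List ℕ+) : H1.toH (H1.z k) = H.word (encode k) := by
  induction k with
  | nil => simp [H1.z, H.word, encode]
  | cons a k ih =>
    have h : H1.z (a :: k) = FreeAlgebra.ι ℚ a * H1.z k := by simp [H1.z]
    rw [h, map_mul, ih]
    simp [H1.toH, H.word, encode, mul_assoc]

theorem decode_replicate (m : ℕ) (w : List Letter) :
    decode (List.replicate m Letter.x ++ w) = ((decode w).1 + m, (decode w).2) := by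
  induction m with
  | zero => simp
  | succ m ih => simp [List.replicate_succ, decode, ih, add_assoc]

theorem decode_encode (k : List ℕ+) : decode (encode k) = (0, k) := by
  induction k with
  | nil => rfl
  | cons a k ih =>
    simp only [encode, decode, decode_replicate, ih, zero_add]
    congr 2
    exact PNat.succPNat_natPred a

theorem toH1_toH (u : H1) : H.toH1 (H1.toH u) = u := by
  have h : H.toH1 ∘ₗ H1.toH.toLinearMap = LinearMap.id := by
    refine H1.basis.ext fun k => ?_
    simp [H1.basis_apply, toH_z, H.toH1_word, decode_encode]
  exact LinearMap.congr_fun h u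

theorem y_mul_word_mem (w : List Letter) : ∀ m : ℕ,
    FreeAlgebra.ι ℚ Letter.y * FreeAlgebra.ι ℚ Letter.x ^ m * H.word w ∈ H1.toH.range := by
  have hz : ∀ m : ℕ,
      FreeAlgebra.ι ℚ Letter.y * FreeAlgebra.ι ℚ Letter.x ^ m ∈ H1.toH.range := fun m =>
    ⟨FreeAlgebra.ι ℚ (Nat.succPNat m), by simp [H1.toH]⟩
  induction w with
  | nil => intro m; simpa [H.word] using hz m
  | cons a w ih =>
    intro m
    cases a with
    | x =>
      have h := ih (m + 1)
      rw [pow_succ] at h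
      simpa [H.word, mul_assoc] using h
    | y =>
      have h := mul_mem (hz m) (ih 0)
      simpa [H.word, mul_assoc] using h

/-- The image of `𝔥¹` contains `y𝔥`. -/
theorem y_mul_mem (v : H) : FreeAlgebra.ι ℚ Letter.y * v ∈ H1.toH.range := by
  have hv : v ∈ Submodule.span ℚ (Set.range H.basis) := by simp [H.basis.span_eq]
  induction hv using Submodule.span_induction with
  | mem v hv =>
    obtain ⟨w, rfl⟩ := hv
    simpa [H.basis_apply] using y_mul_word_mem w 0
  | zero => simp
  | add v w _ _ hv hw => rw [mul_add]; exact add_mem hv hw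
  | smul c v _ hv => rw [mul_smul_comm]; exact Subalgebra.smul_mem _ hv c

theorem shuffleRev_mem (u v : List Letter)
    (hu : ∀ a ∈ u.getLast?, a = Letter.y) (hv : ∀ a ∈ v.getLast?, a = Letter.y)
    (huv : u ≠ [] ∨ v ≠ []) :
    ∃ h : H, shuffleRev u v = FreeAlgebra.ι ℚ Letter.y * h := by
  have base : ∀ w : List Letter, (∀ a ∈ w.getLast?, a = Letter.y) → w ≠ [] →
      ∃ h : H, H.word w.reverse = FreeAlgebra.ι ℚ Letter.y * h := by
    intro w hw hne
    obtain ⟨w', a, rfl⟩ := List.eq_nil_or_concat w |>.resolve_left hne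
    obtain rfl : a = Letter.y := hw a (by simp)
    exact ⟨H.word w'.reverse, by simp [H.word]⟩
  have tail : ∀ (a : Letter) (w : List Letter), (∀ c ∈ (a :: w).getLast?, c = Letter.y) →
      ∀ c ∈ w.getLast?, c = Letter.y := by
    intro a w h c hc
    refine h c ?_
    cases w with
    | nil => simp at hc
    | cons b w => simpa [List.getLast?_cons_cons] using hc
  induction u, v using shuffleRev.induct with
  | case1 v => rw [shuffleRev]; exact base v hv (by simpa using huv)
  | case2 a u => rw [shuffleRev]; exact base _ hu (by simp)
  | case3 a u b v ih1 ih2 =>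
    obtain ⟨h1, e1⟩ := ih1 (tail a u hu) hv (by simp)
    obtain ⟨h2, e2⟩ := ih2 hu (tail b v hv) (by simp)
    exact ⟨h1 * FreeAlgebra.ι ℚ a + h2 * FreeAlgebra.ι ℚ b, by
      rw [shuffleRev, e1, e2, mul_add, mul_assoc, mul_assoc]⟩

theorem encode_head (k : List ℕ+) : ∀ a ∈ (encode k).reverse.getLast?, a = Letter.y := by
  cases k <;> simp [encode]

/-- The shuffle product on `𝔥¹` is the restriction of the one on `𝔥`. -/
theorem toH_shuffle (u v : H1) : H1.toH (shuffle u v) = shuffleH (H1.toH u) (H1.toH v) := by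
  suffices h : shuffle.compr₂ H1.toH.toLinearMap =
      shuffleH.compl₁₂ H1.toH.toLinearMap H1.toH.toLinearMap by
    exact LinearMap.congr_fun₂ h u v
  refine H1.basis.ext fun k => H1.basis.ext fun l => ?_
  have hm : shuffleH (H1.toH (H1.z k)) (H1.toH (H1.z l)) ∈ H1.toH.range := by
    have e : shuffleH (H1.toH (H1.z k)) (H1.toH (H1.z l)) =
        shuffleRev (encode k).reverse (encode l).reverse := by
      rw [toH_z, toH_z, ← H.basis_apply, ← H.basis_apply, shuffleH, Module.Basis.constr_basis,
        Module.Basis.constr_basis]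
    rw [e]
    by_cases hkl : (encode k).reverse ≠ [] ∨ (encode l).reverse ≠ []
    · obtain ⟨h, e⟩ := shuffleRev_mem _ _ (encode_head k) (encode_head l) hkl
      rw [e]
      exact y_mul_mem h
    · push Not at hkl
      rw [hkl.1, hkl.2, shuffleRev]
      simp [H.word]
  obtain ⟨w, hw⟩ := hm
  have hw' : H1.toH w = shuffleH (H1.toH (H1.z k)) (H1.toH (H1.z l)) := hw
  simp [H1.basis_apply, shuffle, ← hw', toH1_toH]

/-! ### Regularized multiple zeta values -/

/-- The two regularizations `∗` and `ш`. -/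
inductive Reg
  | harmonic
  | shuffle

/-- The product `•` on `𝔥¹`. -/
def Reg.mul : Reg → H1 →ₗ[ℚ] H1 →ₗ[ℚ] H1
  | Reg.harmonic => TAdicSMZV.harmonic
  | Reg.shuffle => TAdicSMZV.shuffle

/-- `Z : 𝔥¹ → ℝ[T]` is a `ℚ`-algebra homomorphism for the product `•`, it extends the linear map
`𝔥⁰ → ℝ`, `z_k ↦ ζ(k)` (`k` admissible), and it sends `y = z_1` to `T`.
(It preserves the unit because the empty index is admissible.) -/
structure IsRegularization (b : Reg) (Z : H1 →ₗ[ℚ] ℝ[X]) : Prop where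
  map_mul : ∀ u v : H1, Z (b.mul u v) = Z u * Z v
  map_admissible : ∀ k : List ℕ+, Admissible k → Z (H1.z k) = Polynomial.C (mzv k)
  map_y : Z (H1.z [1]) = Polynomial.X

open Classical in
/-- The map `Z^•`: the unique regularization. -/
def regMap (b : Reg) : H1 →ₗ[ℚ] ℝ[X] :=
  if h : ∃ Z, IsRegularization b Z then h.choose else 0

/-- The regularized multiple zeta value `ζ^•(k)`, the constant term of `Z^•(z_k)`. -/
def regMZV (b : Reg) (k : List ℕ+) : ℝ := (regMap b (H1.z k)).eval 0

/-! ### The `t`-adic symmetric multiple zeta values -/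

/-- The index `k + l` for a tuple `l` of non-negative integers. -/
def addIndex (k : List ℕ+) (l : Fin k.length → ℕ) : List ℕ+ :=
  List.ofFn fun j => (⟨(k.get j : ℕ) + l j, Nat.add_pos_left (k.get j).pos _⟩ : ℕ+)

/-- `b(k; l) = ∏_j (k_j + l_j - 1 choose l_j)`. -/
def binom (k : List ℕ+) (l : Fin k.length → ℕ) : ℕ :=
  ∏ j, ((k.get j : ℕ) + l j - 1).choose (l j)

/-- `ζ^•_Ŝ(k) = ∑_{i=0}^r (-1)^{wt(k^[i])} ζ^•(k_[i]) ∑_l b(k^[i]; l) ζ^•(rev(k^[i] + l)) t^{wt(l)}`,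
where `k_[i]` consists of the first `i` entries of `k`, `k^[i]` of the other ones, and `l` runs over
all tuples of non-negative integers of the length of `k^[i]`. -/
def symMZV (b : Reg) (k : List ℕ+) : ℝ⟦X⟧ :=
  ∑ i ∈ Finset.range (k.length + 1),
    PowerSeries.C ((-1) ^ wt (k.drop i) * regMZV b (k.take i)) *
      PowerSeries.mk fun n =>
        ∑ l ∈ Finset.piAntidiag (Finset.univ : Finset (Fin (k.drop i).length)) n,
          (binom (k.drop i) l : ℝ) * regMZV b (addIndex (k.drop i) l).reverse

/-- The condition on `(n₁, …, n_r)`, for given `i`, in the summation: `0 < n₁ < ⋯ < n_i` and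
`n_{i+1} < ⋯ < n_r < 0`. (The entry `n_{j+1}` is `n j`.) -/
def IsOrdered {r : ℕ} (i : ℕ) (n : Fin r → ℤ) : Prop :=
  (∀ j : Fin r, (j : ℕ) < i → 0 < n j) ∧ (∀ j : Fin r, i ≤ (j : ℕ) → n j < 0) ∧
    ∀ j j' : Fin r, j < j' → ((j' : ℕ) < i ∨ i ≤ (j : ℕ)) → n j < n j'

/-- The truncation condition: for `∗` it says `n_i < M` and `-M < n_{i+1}`, i.e. all entries lie
strictly between `-M` and `M`; for `ш` it says `n_i - n_{i+1} < M`, where `n_0 = n_{r+1} = 0`. -/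
def IsTruncated {r : ℕ} (M i : ℕ) (n : Fin r → ℤ) : Reg → Prop
  | Reg.harmonic => ∀ j, -(M : ℤ) < n j ∧ n j < M
  | Reg.shuffle => (if h : 0 < i ∧ i ≤ r then n ⟨i - 1, by omega⟩ else 0)
      - (if h : i < r then n ⟨i, h⟩ else 0) < (M : ℤ)

theorem IsTruncated.mem_box {r M i : ℕ} (hi : i ≤ r) {n : Fin r → ℤ} {b : Reg}
    (ho : IsOrdered i n) (ht : IsTruncated M i n b) : ∀ j, -(M : ℤ) < n j ∧ n j < M := by
  obtain ⟨hp, hn, hlt⟩ := ho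
  cases b with
  | harmonic => exact ht
  | shuffle =>
    intro j
    unfold IsTruncated at ht
    by_cases hj : (j : ℕ) < i
    · have h1 := hp j hj
      have h2 : n j ≤ n ⟨i - 1, by omega⟩ := by
        rcases Nat.lt_or_ge (j : ℕ) (i - 1) with h | h
        · exact (hlt j ⟨i - 1, by omega⟩ h (Or.inl (by simp; omega))).le
        · exact le_of_eq (congrArg n (Fin.ext (by simp; omega)))
      rw [dif_pos ⟨by omega, hi⟩] at ht
      split_ifs at ht with h
      · have := hn ⟨i, h⟩ le_rfl
        omega
      · omega
    · have h1 := hn j (by omega)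
      have h2 : n ⟨i, by omega⟩ ≤ n j := by
        rcases Nat.lt_or_ge i (j : ℕ) with h | h
        · exact (hlt ⟨i, by omega⟩ j h (Or.inr le_rfl)).le
        · exact le_of_eq (congrArg n (Fin.ext (by simp; omega)))
      rw [dif_pos (show i < r by omega)] at ht
      split_ifs at ht with h
      · have := hp ⟨i - 1, by omega⟩ (by simp; omega)
        omega
      · omega

open Classical in
/-- The `•`-truncated `t`-adic symmetric multiple zeta value `ζ^•_{Ŝ,M}(k)`,
`∑_{i=0}^r ∑_n 1 / (n₁^{k₁} ⋯ n_i^{k_i} (n_{i+1}+t)^{k_{i+1}} ⋯ (n_r+t)^{k_r})`, a power series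
over `ℚ`. All tuples satisfying both conditions lie in the box `(-M, M)^r`
(see `IsTruncated.mem_box`), so the sum over `n` is the sum over all of them. -/
def truncSymMZV (b : Reg) (M : ℕ) (k : List ℕ+) : ℚ⟦X⟧ :=
  ∑ i ∈ Finset.range (k.length + 1),
    ∑ n ∈ Fintype.piFinset (fun _ : Fin k.length => Finset.Ioo (-(M : ℤ)) (M : ℤ)) with
        IsOrdered i n ∧ IsTruncated M i n b,
      ∏ j : Fin k.length,
        if (j : ℕ) < i then (PowerSeries.C ((n j : ℚ) ^ (k.get j : ℕ)))⁻¹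
        else ((PowerSeries.C (n j : ℚ) + PowerSeries.X) ^ (k.get j : ℕ))⁻¹

end TAdicSMZV

end

/-!
# Truncated `t`-adic symmetric multiple zeta values and their limits

Both products on `𝔥¹` are quasi-shuffle products, and for both of them the map `∂` (`del`) which
removes a trailing `z_1` and kills the words ending in `z_a`, `a ≥ 2`, is a derivation. Its kernel
is the span of the admissible `z_k`.

*Regularization.* `∂` is locally nilpotent and `∂ y = 1`, so that `(𝔥¹, •)` is the polynomial ring
in `y` over `ker ∂` (`polynomialEquiv`). The map `Z^•` therefore exists and is unique as soon as `ζ`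
is multiplicative on `ker ∂`. For the harmonic product this follows from the corresponding identity
of truncated sums (`truncZeta_harmonic`); for the shuffle product, the multiple polylogarithms
multiply as power series (`polylog_shuffle`), and their values at `1` multiply by Cauchy's product
formula.

*The limit.* The coefficient of `t ^ n` in the truncated sum is the truncated zeta value of one
element of `𝔥¹`, namely
`V = ∑_i (-1)^{wt(k^[i])} z_{k_[i]} • ∑_l b(k^[i]; l) z_{rev(k^[i] + l)}` (`symElement`), with `l`
of weight `n`: a tuple `(n₁, …, n_r)` splits into its positive and its negative entries, and the
truncation condition turns the resulting double sum into the truncation of a product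
(`truncZeta_mul`). By the Leibniz rule `∂ V` is a telescoping sum, so `∂ V = 0` (`del_symElement`).
Hence `V` is a combination of admissible monomials, its truncated zeta values converge to `ζ(V)`,
and `Z^•(V)` is the constant `ζ(V)`, which is the coefficient of `t ^ n` in the regularized
symmetric multiple zeta value.
-/

noncomputable section

namespace TAdicSMZV

/-! ### Quasi-shuffle products on a free algebra -/

section QuasiShuffle

variable {α : Type}

/-- The monomial of the free algebra given by a word. -/
def word (w : List α) : FreeAlgebra ℚ α := (w.map (FreeAlgebra.ι ℚ)).prod

theorem word_nil : word ([] : List α) = 1 := by simp [word]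

theorem word_concat (w : List α) (a : α) : word (w ++ [a]) = word w * FreeAlgebra.ι ℚ a := by
  simp [word]

/-- The words form a basis of the free algebra. -/
def wordBasis : Module.Basis (List α) ℚ (FreeAlgebra ℚ α) := FreeAlgebra.basisFreeMonoid ℚ α

theorem wordBasis_apply (w : List α) : wordBasis w = word w :=
  (basisFreeMonoid_apply (FreeMonoid.ofList w)).trans (FreeMonoid.lift_ofList _ _)

theorem span_word : Submodule.span ℚ (Set.range (word : List α → FreeAlgebra ℚ α)) = ⊤ := by
  simp [← funext wordBasis_apply]

/-- Two linear maps agree if they agree on words. -/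
theorem linearMap_ext_word {N : Type*} [AddCommMonoid N] [Module ℚ N]
    {F G : FreeAlgebra ℚ α →ₗ[ℚ] N} (h : ∀ w, F (word w) = G (word w)) : F = G :=
  LinearMap.ext_on_range span_word h

/-- Two linear maps agree if they agree at `1` and if agreement at `u` implies agreement at
`u a` for every letter `a`. -/
theorem linearMap_ext_letter {N : Type*} [AddCommMonoid N] [Module ℚ N]
    {F G : FreeAlgebra ℚ α →ₗ[ℚ] N} (h1 : F 1 = G 1)
    (h : ∀ u a, F u = G u → F (u * FreeAlgebra.ι ℚ a) = G (u * FreeAlgebra.ι ℚ a)) : F = G := by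
  refine linearMap_ext_word fun w => ?_
  induction w using List.reverseRecOn with
  | nil => simpa [word_nil] using h1
  | append_singleton w a ih => rw [word_concat]; exact h _ _ ih

/-- `m` is a quasi-shuffle product: it has the unit `1`, and it satisfies
`u a • v b = (u • v b) a + (u a • v) b + c (u • v) f(a, b)` for letters `a`, `b`. The harmonic
product is the case `c = 1`, `f(a, b) = a + b`, and the shuffle product is the case `c = 0`. -/
structure IsQuasiShuffle (c : ℚ) (f : α → α → α)
    (m : FreeAlgebra ℚ α →ₗ[ℚ] FreeAlgebra ℚ α →ₗ[ℚ] FreeAlgebra ℚ α) : Prop where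
  one_mul : ∀ v, m 1 v = v
  mul_one : ∀ u, m u 1 = u
  mul_letter : ∀ u v a b, m (u * FreeAlgebra.ι ℚ a) (v * FreeAlgebra.ι ℚ b) =
    m u (v * FreeAlgebra.ι ℚ b) * FreeAlgebra.ι ℚ a
      + m (u * FreeAlgebra.ι ℚ a) v * FreeAlgebra.ι ℚ b
      + c • (m u v * FreeAlgebra.ι ℚ (f a b))

/-- Right multiplication by a letter. -/
def mulLetter (a : α) : FreeAlgebra ℚ α →ₗ[ℚ] FreeAlgebra ℚ α :=
  LinearMap.mulRight ℚ (FreeAlgebra.ι ℚ a)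

theorem mulLetter_apply (a : α) (u : FreeAlgebra ℚ α) : mulLetter a u = u * FreeAlgebra.ι ℚ a := rfl

/-- It suffices to check the quasi-shuffle recursion on words. -/
theorem IsQuasiShuffle.of_word {c : ℚ} {f : α → α → α}
    {m : FreeAlgebra ℚ α →ₗ[ℚ] FreeAlgebra ℚ α →ₗ[ℚ] FreeAlgebra ℚ α}
    (h1 : ∀ v, m 1 (word v) = word v) (h2 : ∀ u, m (word u) 1 = word u)
    (h : ∀ u v a b, m (word (u ++ [a])) (word (v ++ [b])) =
      m (word u) (word (v ++ [b])) * FreeAlgebra.ι ℚ a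
        + m (word (u ++ [a])) (word v) * FreeAlgebra.ι ℚ b
        + c • (m (word u) (word v) * FreeAlgebra.ι ℚ (f a b))) : IsQuasiShuffle c f m where
  one_mul v := LinearMap.congr_fun (linearMap_ext_word (F := m 1) (G := LinearMap.id) h1) v
  mul_one u := LinearMap.congr_fun
    (linearMap_ext_word (F := m.flip 1) (G := LinearMap.id) h2) u
  mul_letter u v a b := by
    have key : m.compl₁₂ (mulLetter a) (mulLetter b) =
        (m.compl₁₂ LinearMap.id (mulLetter b)).compr₂ (mulLetter a)
        + (m.compl₁₂ (mulLetter a) LinearMap.id).compr₂ (mulLetter b)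
        + c • m.compr₂ (mulLetter (f a b)) := by
      refine linearMap_ext_word fun u => linearMap_ext_word fun v => ?_
      simpa [mulLetter_apply, word_concat] using h u v a b
    simpa [mulLetter_apply] using LinearMap.congr_fun₂ key u v

namespace IsQuasiShuffle

variable {c : ℚ} {f : α → α → α}
  {m : FreeAlgebra ℚ α →ₗ[ℚ] FreeAlgebra ℚ α →ₗ[ℚ] FreeAlgebra ℚ α}

theorem comm (hm : IsQuasiShuffle c f m) (hf : ∀ a b, f a b = f b a) (u v : FreeAlgebra ℚ α) :
    m u v = m v u := by
  suffices h : m = m.flip from LinearMap.congr_fun₂ h u v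
  refine linearMap_ext_letter ?_ fun u a hu => linearMap_ext_letter ?_ fun v b hv => ?_
  · ext1 v
    simp [hm.one_mul, hm.mul_one]
  · simp [hm.one_mul, hm.mul_one]
  · have hu' := fun v => LinearMap.congr_fun hu v
    simp only [LinearMap.flip_apply] at hu' hv ⊢
    rw [hm.mul_letter, hm.mul_letter, hu', hu', hv, hf a b]
    abel

theorem assoc (hm : IsQuasiShuffle c f m) (hf : ∀ a b d, f (f a b) d = f a (f b d))
    (u v w : FreeAlgebra ℚ α) : m (m u v) w = m u (m v w) := by
  -- both sides as trilinear maps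
  suffices h : m.compr₂ m = (LinearMap.lcomp ℚ _ m) ∘ₗ (LinearMap.llcomp ℚ _ _ _) ∘ₗ m by
    exact LinearMap.congr_fun (LinearMap.congr_fun₂ h u v) w
  refine linearMap_ext_letter ?_ fun u a hu => linearMap_ext_letter ?_ fun v b hv =>
    linearMap_ext_letter ?_ fun w d hw => ?_
  · ext v w; simp [hm.one_mul]
  · ext w; simp [hm.one_mul, hm.mul_one]
  · simp [hm.mul_one]
  · have hu' : ∀ v w, m (m u v) w = m u (m v w) := fun v w =>
      LinearMap.congr_fun (LinearMap.congr_fun hu v) w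
    have hv' : ∀ w, m (m (u * FreeAlgebra.ι ℚ a) v) w = m (u * FreeAlgebra.ι ℚ a) (m v w) :=
      fun w => LinearMap.congr_fun hv w
    have hw' : m (m (u * FreeAlgebra.ι ℚ a) (v * FreeAlgebra.ι ℚ b)) w =
      m (u * FreeAlgebra.ι ℚ a) (m (v * FreeAlgebra.ι ℚ b) w) := hw
    change m (m (u * FreeAlgebra.ι ℚ a) (v * FreeAlgebra.ι ℚ b)) (w * FreeAlgebra.ι ℚ d) =
      m (u * FreeAlgebra.ι ℚ a) (m (v * FreeAlgebra.ι ℚ b) (w * FreeAlgebra.ι ℚ d))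
    have e1 := congrArg (· * FreeAlgebra.ι ℚ d) hw'
    simp only [hm.mul_letter, map_add, LinearMap.add_apply, map_smul, LinearMap.smul_apply,
      add_mul, smul_mul_assoc, smul_add, hu', hv', hf] at e1 ⊢
    linear_combination (norm := module) e1

end IsQuasiShuffle

end QuasiShuffle

section StripLetter

variable {α : Type}

/-- The linear map `u a ↦ δ(a) u` (`a` a letter), `1 ↦ 0`. -/
def strip (δ : α → ℚ) : FreeAlgebra ℚ α →ₗ[ℚ] FreeAlgebra ℚ α :=
  wordBasis.constr ℚ fun w : List α =>
    match w.reverse with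
    | [] => 0
    | a :: v => δ a • word v.reverse

theorem strip_one (δ : α → ℚ) : strip δ 1 = 0 := by
  rw [← word_nil, ← wordBasis_apply, strip, Module.Basis.constr_basis]
  rfl

theorem strip_mul_letter (δ : α → ℚ) (u : FreeAlgebra ℚ α) (a : α) :
    strip δ (u * FreeAlgebra.ι ℚ a) = δ a • u := by
  suffices h : strip δ ∘ₗ mulLetter a = δ a • LinearMap.id from LinearMap.congr_fun h u
  refine linearMap_ext_word fun w => ?_
  rw [LinearMap.comp_apply, mulLetter_apply, ← word_concat, ← wordBasis_apply, strip,
    Module.Basis.constr_basis]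
  simp

/-- Stripping the last letter with weights that kill the letters `f(a, b)` is a derivation for the
quasi-shuffle product. -/
theorem IsQuasiShuffle.strip_mul {c : ℚ} {f : α → α → α}
    {m : FreeAlgebra ℚ α →ₗ[ℚ] FreeAlgebra ℚ α →ₗ[ℚ] FreeAlgebra ℚ α}
    (hm : IsQuasiShuffle c f m) {δ : α → ℚ} (hδ : ∀ a b, c * δ (f a b) = 0)
    (u v : FreeAlgebra ℚ α) : strip δ (m u v) = m (strip δ u) v + m u (strip δ v) := by
  suffices h : m.compr₂ (strip δ) = m ∘ₗ strip δ + m.compl₂ (strip δ) from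
    LinearMap.congr_fun₂ h u v
  refine linearMap_ext_letter ?_ fun u a _ => linearMap_ext_letter ?_ fun v b _ => ?_
  · ext v
    simp [hm.one_mul, strip_one]
  · simp [hm.mul_one, strip_one]
  · simp [hm.mul_letter, strip_mul_letter, smul_smul, hδ]

end StripLetter

/-! ### The harmonic product and the shuffle product as quasi-shuffle products -/

theorem H1.z_eq_word (k : List ℕ+) : H1.z k = word k := rfl

theorem H.word_eq_word (w : List Letter) : H.word w = TAdicSMZV.word w := rfl

theorem harmonic_z (k l : List ℕ+) :
    harmonic (H1.z k) (H1.z l) = harmonicRev k.reverse l.reverse := by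
  rw [← H1.basis_apply, ← H1.basis_apply, harmonic, Module.Basis.constr_basis,
    Module.Basis.constr_basis]

theorem shuffleH_word (u v : List Letter) :
    shuffleH (H.word u) (H.word v) = shuffleRev u.reverse v.reverse := by
  rw [← H.basis_apply, ← H.basis_apply, shuffleH, Module.Basis.constr_basis,
    Module.Basis.constr_basis]

theorem isQuasiShuffle_harmonic : IsQuasiShuffle 1 (· + ·) harmonic := by
  refine .of_word (fun v => ?_) (fun u => ?_) fun u v a b => ?_
  · rw [← word_nil, ← H1.z_eq_word, ← H1.z_eq_word, harmonic_z]
    simp [harmonicRev]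
  · rw [← word_nil, ← H1.z_eq_word, ← H1.z_eq_word, harmonic_z]
    rcases h : u.reverse with _ | ⟨a, k⟩ <;>
      obtain rfl := List.reverse_eq_iff.mp h <;> simp [harmonicRev]
  · simp only [← H1.z_eq_word, harmonic_z]
    simp [harmonicRev]

theorem isQuasiShuffle_shuffleH : IsQuasiShuffle 0 (fun _ _ => Letter.x) shuffleH := by
  refine .of_word (fun v => ?_) (fun u => ?_) fun u v a b => ?_
  · rw [← word_nil, ← H.word_eq_word, ← H.word_eq_word, shuffleH_word]
    simp [shuffleRev]
  · rw [← word_nil, ← H.word_eq_word, ← H.word_eq_word, shuffleH_word]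
    rcases h : u.reverse with _ | ⟨a, k⟩ <;>
      obtain rfl := List.reverse_eq_iff.mp h <;> simp [shuffleRev]
  · simp only [← H.word_eq_word, shuffleH_word]
    simp [shuffleRev]

/-- The map `∂ : 𝔥¹ → 𝔥¹` with `∂(w z_1) = w`, `∂(w z_a) = 0` for `a ≥ 2` and `∂ 1 = 0`. It is a
derivation for both products (`del_mul`), and it corresponds to `d/dT` under `Z^•`. -/
def del : H1 →ₗ[ℚ] H1 := strip fun a => if a = 1 then 1 else 0

theorem del_one : del 1 = 0 := strip_one _

theorem del_mul_letter (u : H1) (a : ℕ+) :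
    del (u * FreeAlgebra.ι ℚ a) = if a = 1 then u else 0 := by
  rw [del, strip_mul_letter]; split_ifs <;> simp

theorem toH_mul_letter (u : H1) (a : ℕ+) : H1.toH (u * FreeAlgebra.ι ℚ a) =
    H1.toH u * FreeAlgebra.ι ℚ Letter.y * FreeAlgebra.ι ℚ Letter.x ^ ((a : ℕ) - 1) := by
  simp [H1.toH, mul_assoc]

/-- The map `∂` becomes the removal of a trailing `y` in `𝔥`. -/
theorem toH_del (u : H1) :
    H1.toH (del u) = strip (fun a => match a with | .x => 0 | .y => 1) (H1.toH u) := by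
  suffices h : H1.toH.toLinearMap ∘ₗ del =
    strip (fun a => match a with | .x => 0 | .y => 1) ∘ₗ H1.toH.toLinearMap from
      LinearMap.congr_fun h u
  refine linearMap_ext_letter (by simp [del_one, strip_one]) fun u a _ => ?_
  simp only [LinearMap.comp_apply, AlgHom.toLinearMap_apply, del_mul_letter, toH_mul_letter]
  rcases h : (a : ℕ) - 1 with _ | n
  · have : a = 1 := PNat.coe_eq_one_iff.mp (by have := a.pos; omega)
    simp [this, strip_mul_letter]
  · have : a ≠ 1 := by rintro rfl; simp at h
    rw [pow_succ, ← mul_assoc, strip_mul_letter]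
    simp [this]

theorem toH_injective : Function.Injective H1.toH := Function.LeftInverse.injective toH1_toH

namespace Reg

theorem one_mul (b : Reg) (v : H1) : b.mul 1 v = v := by
  cases b with
  | harmonic => exact isQuasiShuffle_harmonic.one_mul v
  | shuffle =>
    exact toH_injective (by
      rw [Reg.mul, toH_shuffle, map_one]; exact isQuasiShuffle_shuffleH.one_mul _)

theorem mul_comm (b : Reg) (u v : H1) : b.mul u v = b.mul v u := by
  cases b with
  | harmonic => exact isQuasiShuffle_harmonic.comm add_comm u v
  | shuffle =>
    exact toH_injective (by
      simp only [Reg.mul, toH_shuffle]; exact isQuasiShuffle_shuffleH.comm (fun _ _ => rfl) _ _)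

theorem mul_assoc (b : Reg) (u v w : H1) : b.mul (b.mul u v) w = b.mul u (b.mul v w) := by
  cases b with
  | harmonic => exact isQuasiShuffle_harmonic.assoc add_assoc u v w
  | shuffle =>
    exact toH_injective (by
      simp only [Reg.mul, toH_shuffle]
      exact isQuasiShuffle_shuffleH.assoc (fun _ _ _ => rfl) _ _ _)

theorem del_mul (b : Reg) (u v : H1) :
    del (b.mul u v) = b.mul (del u) v + b.mul u (del v) := by
  cases b with
  | harmonic =>
    refine isQuasiShuffle_harmonic.strip_mul (fun a b => ?_) u v
    have : a + b ≠ 1 := fun h => by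
      have := congrArg PNat.val h
      have h1 := a.pos
      have h2 := b.pos
      simp at this
      omega
    simp [this]
  | shuffle =>
    exact toH_injective (by
      simp only [Reg.mul, map_add, toH_shuffle, toH_del]
      exact isQuasiShuffle_shuffleH.strip_mul (by simp) _ _)

end Reg

/-! ### The kernel of `∂` -/

theorem H1.z_nil : H1.z [] = 1 := word_nil

theorem H1.z_concat (k : List ℕ+) (a : ℕ+) :
    H1.z (k ++ [a]) = H1.z k * FreeAlgebra.ι ℚ a := word_concat k a

theorem admissible_concat {k : List ℕ+} {a : ℕ+} : Admissible (k ++ [a]) ↔ 2 ≤ a := by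
  simp [Admissible]

theorem del_z_of_admissible {k : List ℕ+} (hk : Admissible k) : del (H1.z k) = 0 := by
  induction k using List.reverseRecOn with
  | nil => rw [H1.z_nil, del_one]
  | append_singleton k a _ =>
    rw [H1.z_concat, del_mul_letter, if_neg]
    rintro rfl
    exact absurd (admissible_concat.mp hk) (by decide)

/-- The kernel of `∂` is spanned by the monomials of admissible indices: any `u` is the sum of its
admissible part and of `∂(u) z_1`. -/
theorem mem_span_of_del_eq_zero {u : H1} (hu : del u = 0) :
    u ∈ Submodule.span ℚ (H1.z '' {k | Admissible k}) := by
  suffices h : ∀ u : H1, u - del u * FreeAlgebra.ι ℚ 1 ∈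
      Submodule.span ℚ (H1.z '' {k | Admissible k}) by
    simpa [hu] using h u
  intro u
  have hu : u ∈ Submodule.span ℚ (Set.range (word : List ℕ+ → H1)) := span_word ▸ trivial
  induction hu using Submodule.span_induction with
  | mem u hu =>
    obtain ⟨k, rfl⟩ := hu
    rw [← H1.z_eq_word]
    by_cases hk : Admissible k
    · rw [del_z_of_admissible hk, zero_mul, sub_zero]
      exact Submodule.subset_span ⟨k, hk, rfl⟩
    · induction k using List.reverseRecOn with
      | nil => simp [Admissible] at hk
      | append_singleton k a _ =>
        have ha : a = 1 := by
          rw [admissible_concat, not_le] at hk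
          exact le_antisymm (PNat.lt_add_one_iff.mp hk) one_le
        simp [ha, H1.z_concat, del_mul_letter]
  | zero => simp
  | add u v _ _ hu hv =>
    convert add_mem hu hv using 1
    rw [map_add, add_mul]; abel
  | smul c u _ hu =>
    convert Submodule.smul_mem _ c hu using 1
    rw [map_smul, smul_mul_assoc, smul_sub]

theorem exists_iterate_del_eq_zero (u : H1) : ∃ n, del^[n] u = 0 := by
  have hu : u ∈ Submodule.span ℚ (Set.range (word : List ℕ+ → H1)) := span_word ▸ trivial
  induction hu using Submodule.span_induction with
  | mem u hu =>
    obtain ⟨k, rfl⟩ := hu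
    induction k using List.reverseRecOn with
    | nil => exact ⟨1, by simp [word_nil, del_one]⟩
    | append_singleton k a ih =>
      obtain ⟨n, hn⟩ := ih
      refine ⟨n + 1, ?_⟩
      rw [word_concat, Function.iterate_succ_apply, del_mul_letter]
      split_ifs
      · exact hn
      · exact iterate_map_zero del n
  | zero => exact ⟨0, rfl⟩
  | add u v _ _ hu hv =>
    obtain ⟨n, hn⟩ := hu
    obtain ⟨m, hm⟩ := hv
    refine ⟨n + m, ?_⟩
    rw [iterate_map_add, add_comm n m, Function.iterate_add_apply, hn, iterate_map_zero,
      add_comm m n, Function.iterate_add_apply, hm, iterate_map_zero, add_zero]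
  | smul c u _ hu =>
    obtain ⟨n, hn⟩ := hu
    exact ⟨n, by rw [← Module.End.pow_apply, map_smul, Module.End.pow_apply, hn, smul_zero]⟩

section Regularization

open Polynomial

/-! ### Algebras with a locally nilpotent derivation -/

section Nilpotent

variable {A : Type*} [CommRing A] [Algebra ℚ A] (D : Derivation ℚ A A)

/-- The constants of a derivation. -/
def constants : Subalgebra ℚ A where
  carrier := {u | D u = 0}
  mul_mem' {u v} hu hv := by
    simp only [Set.mem_ofPred_eq] at *
    simp [hu, hv]
  add_mem' {u v} hu hv := by
    simp only [Set.mem_ofPred_eq] at *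
    simp [hu, hv]
  algebraMap_mem' c := D.map_algebraMap c

theorem mem_constants {u : A} : u ∈ constants D ↔ D u = 0 := Iff.rfl

variable {D}

/-- On polynomials in `y` over the constants, `D` acts as `d/dy`. -/
theorem derivation_aeval {y : A} (hy : D y = 1) (p : (constants D)[X]) :
    D (aeval y p) = aeval y (derivative p) := by
  induction p using Polynomial.induction_on' with
  | add p q hp hq => simp [hp, hq]
  | monomial n c =>
    have hc : D (algebraMap (constants D) A c) = 0 := c.2
    rw [aeval_monomial, derivative_monomial, aeval_monomial, D.leibniz, hc, D.leibniz_pow, hy]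
    simp
    ring

theorem aeval_injective_of_derivation {y : A} (hy : D y = 1) :
    Function.Injective (aeval y : (constants D)[X] →ₐ[constants D] A) := by
  rw [injective_iff_map_eq_zero]
  intro p
  induction h : p.natDegree using Nat.strong_induction_on generalizing p with
  | _ n ih =>
    intro hp
    have hp' : aeval y (derivative p) = 0 := by rw [← derivation_aeval hy, hp, map_zero]
    have hd : derivative p = 0 := by
      rcases Nat.eq_zero_or_pos n with h0 | h0
      · rw [eq_C_of_natDegree_eq_zero (h.trans h0), derivative_C]
      · exact ih _ (h ▸ natDegree_derivative_lt (by omega)) _ rfl hp'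
    have : IsAddTorsionFree (constants D) := IsAddTorsionFree.of_module_rat _
    rw [eq_C_of_natDegree_eq_zero (derivative_eq_zero.mp hd)] at hp ⊢
    rw [aeval_C] at hp
    have h0 : p.coeff 0 = 0 := Subtype.ext hp
    rw [h0, C_0]

/-- By induction on the order of nilpotency of `u`: if `D u` is a polynomial in `y`, then `u`
differs from an antiderivative of it by a constant. -/
theorem aeval_surjective_of_derivation {y : A} (hy : D y = 1) (hD : ∀ u, ∃ n, D^[n] u = 0) :
    Function.Surjective (aeval y : (constants D)[X] →ₐ[constants D] A) := by
  intro u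
  obtain ⟨n, hn⟩ := hD u
  induction n generalizing u with
  | zero => exact ⟨0, by simpa using hn.symm⟩
  | succ n ih =>
    obtain ⟨p, hp⟩ := ih (D u) hn
    -- an antiderivative of `p`
    obtain ⟨q, hq⟩ : ∃ q : (constants D)[X], derivative q = p := by
      clear hp
      induction p using Polynomial.induction_on' with
      | add p q hp hq =>
        obtain ⟨p', rfl⟩ := hp
        obtain ⟨q', rfl⟩ := hq
        exact ⟨p' + q', derivative_add⟩
      | monomial m c =>
        refine ⟨monomial (m + 1) ((1 / (m + 1) : ℚ) • c), ?_⟩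
        rw [derivative_monomial, Nat.add_sub_cancel]
        congr 1
        have h : ((m : ℚ) + 1) ≠ 0 := by positivity
        rw [mul_comm, ← nsmul_eq_mul, ← Nat.cast_smul_eq_nsmul ℚ, smul_smul]
        push_cast
        rw [mul_one_div_cancel h, one_smul]
    have hc : u - aeval y q ∈ constants D := by
      rw [mem_constants, map_sub, derivation_aeval hy, hq, hp, sub_self]
    refine ⟨q + C ⟨u - aeval y q, hc⟩, ?_⟩
    rw [map_add, aeval_C]
    change aeval y q + (u - aeval y q) = u
    ring

/-- If `D` is locally nilpotent and `D y = 1`, then the algebra is the polynomial ring in `y` over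
the constants of `D`. -/
def polynomialEquiv {y : A} (hy : D y = 1) (hD : ∀ u, ∃ n, D^[n] u = 0) :
    (constants D)[X] ≃ₐ[constants D] A :=
  AlgEquiv.ofBijective (aeval y)
    ⟨aeval_injective_of_derivation hy, aeval_surjective_of_derivation hy hD⟩

/-- Homomorphisms are determined by their values on the constants and at `y`. -/
theorem algHom_ext_of_derivation {B : Type*} [CommRing B] [Algebra ℚ B] {y : A} (hy : D y = 1)
    (hD : ∀ u, ∃ n, D^[n] u = 0) {F G : A →ₐ[ℚ] B} (h : ∀ u, D u = 0 → F u = G u)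
    (hFG : F y = G y) : F = G := by
  ext u
  obtain ⟨p, rfl⟩ := aeval_surjective_of_derivation hy hD u
  induction p using Polynomial.induction_on' with
  | add p q hp hq => simp only [map_add, hp, hq]
  | monomial n c =>
    rw [aeval_monomial, map_mul, map_mul, map_pow, map_pow, hFG]
    congr 1
    exact h _ c.2

/-- A real character of the constants extends to a homomorphism to `ℝ[X]` with `y ↦ X`. -/
theorem exists_algHom_of_derivation {y : A} (hy : D y = 1) (hD : ∀ u, ∃ n, D^[n] u = 0)
    (χ : constants D →ₐ[ℚ] ℝ) :
    ∃ F : A →ₐ[ℚ] ℝ[X], (∀ u : constants D, F u = C (χ u)) ∧ F y = X := by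
  let e := polynomialEquiv hy hD
  refine ⟨(Polynomial.mapAlgHom χ).comp (e.symm.restrictScalars ℚ).toAlgHom, fun u => ?_, ?_⟩
  · have : e.symm (u : A) = C u := by
      rw [AlgEquiv.symm_apply_eq]
      exact (aeval_C y u).symm
    simp [this]
  · have : e.symm y = X := by
      rw [AlgEquiv.symm_apply_eq]
      exact (aeval_X y).symm
    simp [this]

end Nilpotent

/-! ### Existence and uniqueness of the regularization -/

/-- The space `𝔥¹`, to be equipped with the product `•` as its multiplication. -/
def RegAlgebra (_ : Reg) : Type := H1

namespace RegAlgebra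

variable (b : Reg)

instance : AddCommGroup (RegAlgebra b) := inferInstanceAs (AddCommGroup H1)

instance : Module ℚ (RegAlgebra b) := inferInstanceAs (Module ℚ H1)

instance : CommRing (RegAlgebra b) where
  __ := (inferInstance : AddCommGroup (RegAlgebra b))
  mul u v := b.mul u v
  one := (1 : H1)
  left_distrib u v w := (b.mul u).map_add v w
  right_distrib u v w := LinearMap.map_add₂ b.mul u v w
  zero_mul u := LinearMap.map_zero₂ b.mul u
  mul_zero u := (b.mul u).map_zero
  mul_assoc := b.mul_assoc
  one_mul := b.one_mul
  mul_one u := (b.mul_comm u 1).trans (b.one_mul u)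
  mul_comm := b.mul_comm

instance : Algebra ℚ (RegAlgebra b) :=
  Algebra.ofModule (fun c u v => LinearMap.map_smul₂ b.mul c u v)
    fun c u v => (b.mul u).map_smul c v

/-- The identity map from `𝔥¹` to the algebra with the product `•`. -/
def of : H1 ≃ₗ[ℚ] RegAlgebra b := LinearEquiv.refl ℚ H1

theorem of_mul (u v : H1) : of b (b.mul u v) = of b u * of b v := rfl

theorem of_one : of b 1 = 1 := rfl

/-- The derivation `∂`. -/
def derivation : Derivation ℚ (RegAlgebra b) (RegAlgebra b) :=
  Derivation.mk' ((of b).toLinearMap ∘ₗ del ∘ₗ (of b).symm.toLinearMap) fun u v => by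
    obtain ⟨u, rfl⟩ := (of b).surjective u
    obtain ⟨v, rfl⟩ := (of b).surjective v
    change of b (del (b.mul u v)) = of b u * of b (del v) + of b v * of b (del u)
    rw [b.del_mul, map_add, of_mul, of_mul]
    ring

theorem derivation_of (u : H1) : derivation b (of b u) = of b (del u) := rfl

theorem derivation_y : derivation b (of b (H1.z [1])) = 1 := by
  have h := del_mul_letter (H1.z []) 1
  rw [← H1.z_concat, H1.z_nil, if_pos rfl] at h
  rw [derivation_of, ← of_one]
  exact congrArg (of b) h

theorem derivation_nilpotent (u : RegAlgebra b) : ∃ n, (derivation b)^[n] u = 0 :=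
  exists_iterate_del_eq_zero u

end RegAlgebra

theorem mzv_nil : mzv [] = 1 := by
  have : Unique {n : Fin ([] : List ℕ+).length → ℕ // StrictMono n ∧ ∀ j, 0 < n j} :=
    { default := ⟨fun _ => 1, fun i => i.elim0, fun i => i.elim0⟩
      uniq := fun n => Subtype.ext (funext fun i => i.elim0) }
  rw [mzv, tsum_fintype]
  simp

variable {b : Reg} {Z : H1 →ₗ[ℚ] ℝ[X]}

theorem IsRegularization.map_one (hZ : IsRegularization b Z) : Z 1 = 1 := by
  rw [← H1.z_nil, hZ.map_admissible [] (by simp [Admissible]), mzv_nil, C_1]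

/-- A regularization as a homomorphism of algebras. -/
def IsRegularization.algHom (hZ : IsRegularization b Z) : RegAlgebra b →ₐ[ℚ] ℝ[X] :=
  AlgHom.ofLinearMap (Z ∘ₗ (RegAlgebra.of b).symm.toLinearMap) hZ.map_one hZ.map_mul

/-- The linear map `z_k ↦ ζ(k)`; it is only of interest on the span of the admissible `z_k`. -/
def zetaMap : H1 →ₗ[ℚ] ℝ := H1.basis.constr ℚ mzv

theorem zetaMap_z (k : List ℕ+) : zetaMap (H1.z k) = mzv k := by
  rw [← H1.basis_apply, zetaMap, Module.Basis.constr_basis]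

/-- On the kernel of `∂`, a regularization takes constant values. -/
theorem IsRegularization.map_of_del_eq_zero (hZ : IsRegularization b Z) {u : H1} (hu : del u = 0) :
    Z u = Polynomial.C (zetaMap u) := by
  have hu' := mem_span_of_del_eq_zero hu
  clear hu
  induction hu' using Submodule.span_induction with
  | mem u hu =>
    obtain ⟨k, hk, rfl⟩ := hu
    rw [hZ.map_admissible k hk, zetaMap_z]
  | zero => simp
  | add u v _ _ hu hv => simp [hu, hv]
  | smul c u _ hu =>
    rw [map_smul, map_smul, hu, Polynomial.smul_C]

theorem IsRegularization.unique {Z' : H1 →ₗ[ℚ] ℝ[X]} (hZ : IsRegularization b Z)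
    (hZ' : IsRegularization b Z') : Z = Z' := by
  have h : hZ.algHom = hZ'.algHom :=
    algHom_ext_of_derivation (RegAlgebra.derivation_y b) (RegAlgebra.derivation_nilpotent b)
      (fun u hu => (hZ.map_of_del_eq_zero hu).trans (hZ'.map_of_del_eq_zero hu).symm)
      (hZ.map_y.trans hZ'.map_y.symm)
  ext1 u
  exact DFunLike.congr_fun h (RegAlgebra.of b u)

/-- A regularization exists as soon as `ζ` is multiplicative on the kernel of `∂`. -/
theorem exists_isRegularization (b : Reg)
    (h : ∀ u v, del u = 0 → del v = 0 → zetaMap (b.mul u v) = zetaMap u * zetaMap v) :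
    ∃ Z, IsRegularization b Z := by
  let χ : constants (RegAlgebra.derivation b) →ₐ[ℚ] ℝ :=
    AlgHom.ofLinearMap
      (zetaMap ∘ₗ (RegAlgebra.of b).symm.toLinearMap ∘ₗ (constants _).val.toLinearMap)
      (by
        change zetaMap 1 = 1
        rw [← H1.z_nil, zetaMap_z, mzv_nil])
      (fun u v => h u.1 v.1 u.2 v.2)
  obtain ⟨F, hF, hFy⟩ := exists_algHom_of_derivation (RegAlgebra.derivation_y b)
    (RegAlgebra.derivation_nilpotent b) χ
  refine ⟨F.toLinearMap ∘ₗ (RegAlgebra.of b).toLinearMap, fun u v => map_mul F _ _, fun k hk => ?_,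
    hFy⟩
  refine (hF ⟨RegAlgebra.of b (H1.z k), del_z_of_admissible hk⟩).trans ?_
  exact congrArg C (zetaMap_z k)

end Regularization

section Polylogarithm

open PowerSeries

/-! ### Multiple polylogarithms as power series -/

/-- The operator `F ↦ ∫ F dz/z` on power series. A constant term of `F` is ignored: the coefficient
of degree `0` is divided by zero, with value `0`. -/
def integrate : ℚ⟦X⟧ →ₗ[ℚ] ℚ⟦X⟧ where
  toFun F := PowerSeries.mk fun p => coeff p F / p
  map_add' F G := by ext p; simp [add_div]
  map_smul' c F := by ext p; simp [mul_div_assoc]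

theorem coeff_integrate (F : ℚ⟦X⟧) (p : ℕ) : coeff p (integrate F) = coeff p F / p := by
  simp [integrate]

theorem constantCoeff_integrate (F : ℚ⟦X⟧) : constantCoeff (integrate F) = 0 := by
  rw [← coeff_zero_eq_constantCoeff_apply, coeff_integrate]
  simp

theorem X_mul_derivative_integrate {F : ℚ⟦X⟧} (hF : constantCoeff F = 0) :
    X * d⁄dX ℚ (integrate F) = F := by
  ext p
  cases p with
  | zero => simp [hF]
  | succ p =>
    rw [coeff_succ_X_mul, coeff_derivative, coeff_integrate]
    push_cast
    field_simp

/-- Integration by parts. -/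
theorem integrate_mul_integrate {F G : ℚ⟦X⟧} (hF : constantCoeff F = 0)
    (hG : constantCoeff G = 0) :
    integrate F * integrate G = integrate (F * integrate G) + integrate (G * integrate F) := by
  refine derivative.ext ?_ (by simp [constantCoeff_integrate])
  have h : X * d⁄dX ℚ (integrate F * integrate G) =
      X * d⁄dX ℚ (integrate (F * integrate G) + integrate (G * integrate F)) := by
    rw [map_add, mul_add, X_mul_derivative_integrate (by simp [hF]),
      X_mul_derivative_integrate (by simp [hG]), Derivation.leibniz, smul_eq_mul, smul_eq_mul]
    linear_combination integrate F * X_mul_derivative_integrate hG +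
      integrate G * X_mul_derivative_integrate hF
  exact mul_left_cancel₀ X_ne_zero h

/-- The forms `dz/z` (for `x`) and `dz/(1-z)` (for `y`), divided by `dz/z`. -/
def letterForm : Letter → ℚ⟦X⟧
  | Letter.x => 1
  | Letter.y => X * PowerSeries.mk 1

/-- The iterated integral of a word which is given in reversed order. -/
def polylogRev : List Letter → ℚ⟦X⟧
  | [] => 1
  | a :: w => integrate (letterForm a * polylogRev w)

/-- The iterated integral as a linear map on `𝔥`; it is the multiple polylogarithm `Li` on words
starting with `y`. -/
def polylogH : H →ₗ[ℚ] ℚ⟦X⟧ := wordBasis.constr ℚ fun w => polylogRev w.reverse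

theorem polylogH_word (w : List Letter) : polylogH (H.word w) = polylogRev w.reverse := by
  rw [H.word_eq_word, ← wordBasis_apply, polylogH, Module.Basis.constr_basis]

theorem polylogH_mul_letter (u : H) (a : Letter) :
    polylogH (u * FreeAlgebra.ι ℚ a) = integrate (letterForm a * polylogH u) := by
  suffices h : polylogH ∘ₗ mulLetter a =
    integrate ∘ₗ (LinearMap.mulLeft ℚ (letterForm a)) ∘ₗ polylogH from LinearMap.congr_fun h u
  refine linearMap_ext_word fun w => ?_
  simp only [LinearMap.comp_apply, mulLetter_apply, ← word_concat, LinearMap.mulLeft_apply]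
  rw [← H.word_eq_word, ← H.word_eq_word, polylogH_word, polylogH_word]
  simp [polylogRev]

/-- The integrands of the iterated integrals of words in `y𝔥` have no constant term. -/
theorem constantCoeff_letterForm_mul {a : Letter} {u : List Letter}
    (h : ∀ c ∈ (a :: u).getLast?, c = Letter.y) :
    constantCoeff (letterForm a * polylogRev u) = 0 := by
  cases a with
  | y => simp [letterForm]
  | x =>
    cases u with
    | nil => simp at h
    | cons b u => simp [polylogRev, constantCoeff_integrate]

/-- Iterated integrals multiply by the shuffle product, for words (in reversed order) which are
empty or start with `y`. Without this condition the identity fails, as a leading `x` would produce a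
logarithm. -/
theorem polylogH_shuffleRev (u v : List Letter) (hu : ∀ a ∈ u.getLast?, a = Letter.y)
    (hv : ∀ a ∈ v.getLast?, a = Letter.y) :
    polylogH (shuffleRev u v) = polylogRev u * polylogRev v := by
  have tail : ∀ (a : Letter) (w : List Letter), (∀ c ∈ (a :: w).getLast?, c = Letter.y) →
      ∀ c ∈ w.getLast?, c = Letter.y := by
    intro a w h c hc
    refine h c ?_
    cases w with
    | nil => simp at hc
    | cons b w => simpa [List.getLast?_cons_cons] using hc
  induction u, v using shuffleRev.induct with
  | case1 v => rw [shuffleRev, polylogH_word, List.reverse_reverse, polylogRev, one_mul]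
  | case2 a u =>
    rw [shuffleRev, polylogH_word, List.reverse_reverse, polylogRev, polylogRev, mul_one]
  | case3 a u b v ih1 ih2 =>
    rw [shuffleRev, map_add, polylogH_mul_letter, polylogH_mul_letter, ih1 (tail a u hu) hv,
      ih2 hu (tail b v hv)]
    simp only [polylogRev]
    rw [integrate_mul_integrate (constantCoeff_letterForm_mul hu) (constantCoeff_letterForm_mul hv)]
    congr 2 <;> ring

/-- The multiple polylogarithms, `z_k ↦ Li_k(z) = ∑_{0 < n₁ < ⋯ < n_r} z^(n_r) / (n₁^k₁ ⋯ n_r^k_r)`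
(see `coeff_polylog_mul_letter`). -/
def polylog : H1 →ₗ[ℚ] ℚ⟦X⟧ := polylogH ∘ₗ H1.toH.toLinearMap

theorem polylog_shuffle (u v : H1) : polylog (shuffle u v) = polylog u * polylog v := by
  suffices h : shuffle.compr₂ polylog = (LinearMap.mul ℚ ℚ⟦X⟧).compl₁₂ polylog polylog from
    LinearMap.congr_fun₂ h u v
  refine linearMap_ext_word fun k => linearMap_ext_word fun l => ?_
  simp only [LinearMap.compr₂_apply, LinearMap.compl₁₂_apply, LinearMap.mul_apply', polylog,
    LinearMap.comp_apply, AlgHom.toLinearMap_apply, toH_shuffle, ← H1.z_eq_word, toH_z,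
    shuffleH_word, polylogH_word]
  exact polylogH_shuffleRev _ _ (encode_head k) (encode_head l)

theorem polylog_one : polylog 1 = 1 := by
  rw [← H1.z_nil, polylog, LinearMap.comp_apply, AlgHom.toLinearMap_apply, toH_z, polylogH_word]
  rfl

theorem coeff_letterForm_y_mul (F : ℚ⟦X⟧) (p : ℕ) :
    coeff p (letterForm Letter.y * F) = ∑ q ∈ Finset.range p, coeff q F := by
  cases p with
  | zero => simp [letterForm]
  | succ p =>
    rw [letterForm, mul_assoc, coeff_succ_X_mul, mul_comm, coeff_mul,
      Finset.Nat.sum_antidiagonal_eq_sum_range_succ_mk]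
    simp

theorem coeff_polylog_mul_letter (u : H1) (a : ℕ+) (p : ℕ) :
    coeff p (polylog (u * FreeAlgebra.ι ℚ a)) =
      ((p : ℚ) ^ (a : ℕ))⁻¹ * ∑ q ∈ Finset.range p, coeff q (polylog u) := by
  obtain ⟨n, hn⟩ : ∃ n, (a : ℕ) = n + 1 := ⟨a - 1, by have := a.pos; omega⟩
  simp only [polylog, LinearMap.comp_apply, AlgHom.toLinearMap_apply, toH_mul_letter, hn,
    Nat.add_sub_cancel]
  generalize H1.toH u = w
  clear hn
  induction n with
  | zero =>
    rw [pow_zero, mul_one, polylogH_mul_letter, coeff_integrate, coeff_letterForm_y_mul]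
    simp [div_eq_inv_mul]
  | succ n ih =>
    rw [pow_succ, ← mul_assoc, polylogH_mul_letter, letterForm, one_mul, coeff_integrate, ih,
      pow_succ _ (n + 1), mul_inv]
    ring

/-! ### Truncated multiple zeta values -/

/-- The truncated multiple zeta values, `z_k ↦ ∑_{0 < n₁ < ⋯ < n_r < M} 1 / (n₁^k₁ ⋯ n_r^k_r)`. For
`M = 0` this is the zero map, also at the empty index. -/
def truncZeta (M : ℕ) : H1 →ₗ[ℚ] ℚ := ∑ p ∈ Finset.range M, coeff p ∘ₗ polylog

theorem truncZeta_apply (M : ℕ) (u : H1) :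
    truncZeta M u = ∑ p ∈ Finset.range M, coeff p (polylog u) := by
  simp [truncZeta]

theorem truncZeta_succ_one (M : ℕ) : truncZeta (M + 1) 1 = 1 := by
  simp [truncZeta_apply, polylog_one, coeff_one]

theorem coeff_polylog_mul_letter_eq_truncZeta (u : H1) (a : ℕ+) (p : ℕ) :
    coeff p (polylog (u * FreeAlgebra.ι ℚ a)) = ((p : ℚ) ^ (a : ℕ))⁻¹ * truncZeta p u := by
  rw [coeff_polylog_mul_letter, truncZeta_apply]

theorem truncZeta_succ_mul_letter (M : ℕ) (u : H1) (a : ℕ+) :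
    truncZeta (M + 1) (u * FreeAlgebra.ι ℚ a) =
      truncZeta M (u * FreeAlgebra.ι ℚ a) + ((M : ℚ) ^ (a : ℕ))⁻¹ * truncZeta M u := by
  rw [truncZeta_apply, Finset.sum_range_succ, ← truncZeta_apply,
    coeff_polylog_mul_letter_eq_truncZeta]

/-- Truncated sums are multiplicative for the harmonic product: raising `M` by one changes both
sides by terms which the recursion for the product matches. -/
theorem truncZeta_harmonic (M : ℕ) (u v : H1) :
    truncZeta M (harmonic u v) = truncZeta M u * truncZeta M v := by
  induction M generalizing u v with
  | zero => simp [truncZeta_apply]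
  | succ M ih =>
    suffices h : harmonic.compr₂ (truncZeta (M + 1)) =
        (LinearMap.mul ℚ ℚ).compl₁₂ (truncZeta (M + 1)) (truncZeta (M + 1)) from
      LinearMap.congr_fun₂ h u v
    have hm := isQuasiShuffle_harmonic
    refine linearMap_ext_letter ?_ fun u a _ => linearMap_ext_letter ?_ fun v b _ => ?_
    · ext1 v
      simp [hm.one_mul, truncZeta_succ_one]
    · simp [hm.mul_one, truncZeta_succ_one]
    · simp only [LinearMap.compr₂_apply, LinearMap.compl₁₂_apply, LinearMap.mul_apply']
      have e := ih (u * FreeAlgebra.ι ℚ a) (v * FreeAlgebra.ι ℚ b)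
      rw [hm.mul_letter] at e ⊢
      simp only [map_add, one_smul, truncZeta_succ_mul_letter, ih] at e ⊢
      rw [PNat.add_coe, pow_add, mul_inv]
      linear_combination e

/-- The condition on the largest entries `p`, `q` of two index tuples with entries below `M` under
which the pair contributes to the truncated sum. -/
def PairTruncated (M p q : ℕ) : Reg → Prop
  | Reg.harmonic => True
  | Reg.shuffle => p + q < M

open Classical in
/-- The truncated multiple zeta values of a product, as a truncated double sum. -/
theorem truncZeta_mul (b : Reg) (M : ℕ) (u v : H1) :
    truncZeta M (b.mul u v) = ∑ p ∈ Finset.range M, ∑ q ∈ Finset.range M,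
      if PairTruncated M p q b then coeff p (polylog u) * coeff q (polylog v) else 0 := by
  cases b with
  | harmonic =>
    simp only [if_pos (show PairTruncated M _ _ Reg.harmonic from trivial), Reg.mul,
      truncZeta_harmonic]
    rw [truncZeta_apply, truncZeta_apply, Finset.sum_mul_sum]
  | shuffle =>
    rw [Reg.mul, truncZeta_apply, polylog_shuffle, ← Finset.sum_product', ← Finset.sum_filter,
      ← Finset.sum_fiberwise_of_maps_to (t := Finset.range M) (g := fun x : ℕ × ℕ => x.1 + x.2)
        (fun x hx => by
          simpa using (show x.1 + x.2 < M from (Finset.mem_filter.mp hx).2))]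
    refine Finset.sum_congr rfl fun N hN => ?_
    rw [coeff_mul]
    refine Finset.sum_congr ?_ fun _ _ => rfl
    ext ⟨p, q⟩
    rw [Finset.HasAntidiagonal.mem_antidiagonal, Finset.mem_filter, Finset.mem_filter,
      Finset.mem_product]
    simp only [Finset.mem_range, PairTruncated] at hN ⊢
    omega

end Polylogarithm

section Convergence

open PowerSeries Filter Topology

/-! ### Sums over increasing tuples -/

/-- The increasing tuples of positive integers below `M`. -/
def increasing (r M : ℕ) : Finset (Fin r → ℕ) :=
  (Fintype.piFinset fun _ => Finset.range M).filter fun n => StrictMono n ∧ ∀ j, 0 < n j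

theorem mem_increasing {r M : ℕ} {n : Fin r → ℕ} :
    n ∈ increasing r M ↔ (∀ j, n j < M) ∧ StrictMono n ∧ ∀ j, 0 < n j := by
  simp [increasing]

/-- The sum `∑_{0 < n₁ < ⋯ < n_r = p} ∏_j e(k_j, n_j)` for an index `(k₁, …, k_r)` given in reversed
order; for the empty index it is `1` if `p = 0` and `0` otherwise. -/
def nestedSum {R : Type*} [CommRing R] (e : ℕ+ → ℕ → R) : List ℕ+ → ℕ → R
  | [], p => if p = 0 then 1 else 0
  | a :: k, p => if p = 0 then 0 else e a p * ∑ q ∈ Finset.range p, nestedSum e k q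

theorem strictMono_snoc_iff {r : ℕ} {n : Fin (r + 1) → ℕ} :
    StrictMono n ↔ StrictMono (Fin.init n) ∧ ∀ j, Fin.init n j < n (Fin.last r) := by
  constructor
  · exact fun h => ⟨fun i j hij => h (Fin.castSucc_lt_castSucc_iff.mpr hij),
      fun j => h (Fin.castSucc_lt_last j)⟩
  · rintro ⟨h1, h2⟩ i j hij
    induction j using Fin.lastCases with
    | last =>
      induction i using Fin.lastCases with
      | last => exact absurd hij (lt_irrefl _)
      | cast i => exact h2 i
    | cast j =>
      induction i using Fin.lastCases with
      | last => exact absurd (hij.trans (Fin.castSucc_lt_last j)) (lt_irrefl _)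
      | cast i => exact h1 (Fin.castSucc_lt_castSucc_iff.mp hij)

theorem sup_eq_last {r : ℕ} {n : Fin (r + 1) → ℕ} (hn : StrictMono n) :
    Finset.univ.sup n = n (Fin.last r) :=
  le_antisymm (Finset.sup_le fun j _ => hn.monotone (Fin.le_last j))
    (Finset.le_sup (Finset.mem_univ _))

/-- Sums over increasing tuples, weighted by a function of the largest entry, as nested sums. -/
theorem sum_increasing {R : Type*} [CommRing R] (e : ℕ+ → ℕ → R) {M : ℕ} (hM : 0 < M) {r : ℕ}
    (κ : Fin r → ℕ+) (φ : ℕ → R) :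
    ∑ n ∈ increasing r M, (∏ j, e (κ j) (n j)) * φ (Finset.univ.sup n) =
      ∑ p ∈ Finset.range M, nestedSum e (List.ofFn κ).reverse p * φ p := by
  induction r generalizing φ with
  | zero =>
    have h : increasing 0 M = {fun i => i.elim0} := by
      ext n
      simp only [mem_increasing, Finset.mem_singleton]
      exact ⟨fun _ => funext fun i => i.elim0, fun _ => ⟨fun i => i.elim0, fun i => i.elim0,
        fun i => i.elim0⟩⟩
    simp [h, nestedSum, hM.ne']
  | succ r ih =>
    -- split off the last entry `p`
    have step : ∑ n ∈ increasing (r + 1) M, (∏ j, e (κ j) (n j)) * φ (Finset.univ.sup n) =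
        ∑ p ∈ Finset.range M, ∑ u ∈ increasing r M, if 0 < p ∧ Finset.univ.sup u < p then
          (∏ j, e (κ (Fin.castSucc j)) (u j)) * (e (κ (Fin.last r)) p * φ p) else 0 := by
      rw [← Finset.sum_product', ← Finset.sum_filter]
      refine Finset.sum_nbij' (fun n => (n (Fin.last r), Fin.init n))
        (fun x => Fin.snoc (α := fun _ => ℕ) x.2 x.1) ?_ ?_ (fun n _ => Fin.snoc_init_self n) ?_ ?_
      · intro n hn
        rw [mem_increasing, strictMono_snoc_iff] at hn
        obtain ⟨h1, ⟨h2, h3⟩, h4⟩ := hn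
        simp only [Finset.mem_filter, Finset.mem_product, Finset.mem_range, mem_increasing]
        exact ⟨⟨h1 _, fun j => h1 _, h2, fun j => h4 _⟩, h4 _,
          (Finset.sup_lt_iff (h4 _)).mpr fun j _ => h3 j⟩
      · rintro ⟨p, u⟩ hx
        simp only [Finset.mem_filter, Finset.mem_product, Finset.mem_range, mem_increasing] at hx
        obtain ⟨⟨h1, h2, h3, h4⟩, h5, h6⟩ := hx
        rw [mem_increasing, strictMono_snoc_iff, Fin.init_snoc, Fin.snoc_last]
        refine ⟨fun j => ?_, ⟨h3, fun j => (Finset.le_sup (Finset.mem_univ j)).trans_lt h6⟩,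
          fun j => ?_⟩ <;>
        induction j using Fin.lastCases <;> simp [*]
      · rintro ⟨p, u⟩ _
        simp
      · intro n hn
        rw [Fin.prod_univ_castSucc, sup_eq_last (mem_increasing.mp hn).2.1, mul_assoc]
        rfl
    rw [step]
    refine Finset.sum_congr rfl fun p hp => ?_
    rw [Finset.mem_range] at hp
    rw [List.ofFn_succ_last, List.reverse_append, List.reverse_singleton, List.singleton_append,
      nestedSum]
    rcases Nat.eq_zero_or_pos p with h0 | h0
    · simp [h0]
    -- the induction hypothesis for the weight `q ↦ [q < p]` yields the inner nested sum
    · have h := ih (fun j => κ (Fin.castSucc j)) fun q => if q < p then 1 else 0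
      simp only [mul_ite, mul_one, mul_zero] at h
      rw [← Finset.sum_filter (s := Finset.range M),
        show (Finset.range M).filter (· < p) = Finset.range p by ext; simp; omega] at h
      rw [if_neg h0.ne', ← h, mul_right_comm, Finset.mul_sum]
      refine Finset.sum_congr rfl fun u _ => ?_
      simp only [h0, true_and]
      split_ifs
      · ring
      · simp

theorem coeff_polylog_z (k : List ℕ+) (p : ℕ) :
    coeff p (polylog (H1.z k)) =
      nestedSum (fun a n => ((n : ℚ) ^ (a : ℕ))⁻¹) k.reverse p := by
  induction k using List.reverseRecOn generalizing p with
  | nil => rw [H1.z_nil, polylog_one, coeff_one]; rfl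
  | append_singleton k a ih =>
    rw [H1.z_concat, coeff_polylog_mul_letter, List.reverse_append, List.reverse_singleton,
      List.singleton_append, nestedSum]
    split_ifs with h
    · simp [h]
    · simp [ih]

theorem truncZeta_z {M : ℕ} (hM : 0 < M) (k : List ℕ+) :
    truncZeta M (H1.z k) =
      ∑ n ∈ increasing k.length M, ∏ j, ((n j : ℚ) ^ (k.get j : ℕ))⁻¹ := by
  have h := sum_increasing (fun a n => ((n : ℚ) ^ (a : ℕ))⁻¹) hM k.get fun _ => 1
  simp only [mul_one] at h
  rw [h, truncZeta_apply, List.ofFn_get]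
  exact Finset.sum_congr rfl fun p _ => coeff_polylog_z k p

/-! ### Convergence of the series for admissible indices -/

theorem coeff_polylog_z_nonneg (k : List ℕ+) (p : ℕ) : 0 ≤ coeff p (polylog (H1.z k)) := by
  induction k using List.reverseRecOn generalizing p with
  | nil => rw [H1.z_nil, polylog_one, coeff_one]; split_ifs <;> simp
  | append_singleton k a ih =>
    rw [H1.z_concat, coeff_polylog_mul_letter]
    exact mul_nonneg (by positivity) (Finset.sum_nonneg fun q _ => ih q)

theorem truncZeta_z_nonneg (k : List ℕ+) (M : ℕ) : 0 ≤ truncZeta M (H1.z k) := by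
  rw [truncZeta_apply]
  exact Finset.sum_nonneg fun p _ => coeff_polylog_z_nonneg k p

theorem truncZeta_z_mono (k : List ℕ+) : Monotone fun M => truncZeta M (H1.z k) := by
  intro M N h
  simp only [truncZeta_apply]
  exact Finset.sum_le_sum_of_subset_of_nonneg (Finset.range_mono h)
    fun p _ _ => coeff_polylog_z_nonneg k p

/-- Truncated multiple zeta values grow at most like powers of the harmonic numbers. -/
theorem truncZeta_z_le (k : List ℕ+) (M : ℕ) :
    truncZeta M (H1.z k) ≤ (_root_.harmonic M) ^ k.length := by
  induction k using List.reverseRecOn generalizing M with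
  | nil =>
    rcases M with _ | M
    · simp [truncZeta_apply]
    · simp [H1.z_nil, truncZeta_succ_one]
  | append_singleton k a ih =>
    rcases M with _ | M
    · simp [truncZeta_apply]
    have hle : truncZeta (M + 1) (H1.z (k ++ [a])) ≤
        ∑ p ∈ Finset.range M, ((p + 1 : ℕ) : ℚ)⁻¹ * truncZeta (M + 1) (H1.z k) := by
      rw [H1.z_concat, truncZeta_apply, Finset.sum_range_succ',
        coeff_polylog_mul_letter_eq_truncZeta _ _ 0]
      simp only [CharP.cast_eq_zero, ne_eq, PNat.ne_zero, not_false_eq_true, zero_pow, inv_zero,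
        zero_mul, add_zero]
      refine Finset.sum_le_sum fun p hp => ?_
      rw [Finset.mem_range] at hp
      rw [coeff_polylog_mul_letter_eq_truncZeta]
      refine mul_le_mul ?_ (truncZeta_z_mono k (by omega)) (truncZeta_z_nonneg k _) (by positivity)
      refine inv_anti₀ (by positivity) (le_self_pow₀ ?_ a.pos.ne')
      exact_mod_cast Nat.succ_le_succ (Nat.zero_le p)
    rw [← Finset.sum_mul] at hle
    have hH : ∑ p ∈ Finset.range M, ((p + 1 : ℕ) : ℚ)⁻¹ ≤ _root_.harmonic (M + 1) := by
      rw [harmonic_succ]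
      exact le_add_of_nonneg_right (by positivity)
    have hH0 : 0 ≤ _root_.harmonic (M + 1) := (harmonic_pos (by omega)).le
    rw [List.length_append, List.length_singleton, pow_succ']
    exact hle.trans (mul_le_mul hH (ih _) (truncZeta_z_nonneg k _) hH0)

theorem summable_one_add_log_pow_div_sq (r : ℕ) :
    Summable fun p : ℕ => (1 + Real.log p) ^ r / (p : ℝ) ^ 2 := by
  refine summable_of_isBigO_nat
    (Real.summable_one_div_nat_rpow.mpr (by norm_num : (1 : ℝ) < 3 / 2)) ?_
  -- `1 + log p = log (e p)` is smaller than any positive power of `p`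
  have h1 : (fun p : ℕ => (Real.log (Real.exp 1 * p)) ^ (r : ℝ)) =o[atTop]
      fun p : ℕ => (Real.exp 1 * (p : ℝ)) ^ (1 / 2 : ℝ) :=
    (isLittleO_log_rpow_rpow_atTop (r : ℝ) (by norm_num : (0 : ℝ) < 1 / 2)).comp_tendsto
      (tendsto_natCast_atTop_atTop.const_mul_atTop (Real.exp_pos 1))
  have h2 : (fun p : ℕ => (1 + Real.log p) ^ r) =O[atTop] fun p : ℕ => (p : ℝ) ^ (1 / 2 : ℝ) := by
    refine (h1.isBigO.congr' ?_ ?_).trans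
      (Asymptotics.isBigO_const_mul_self (Real.exp 1 ^ (1 / 2 : ℝ)) _ _)
    · filter_upwards [eventually_gt_atTop 0] with p hp
      rw [Real.rpow_natCast, Real.log_mul (Real.exp_pos 1).ne' (by positivity), Real.log_exp]
    · filter_upwards with p
      rw [Real.mul_rpow (Real.exp_pos 1).le (Nat.cast_nonneg p)]
  refine (h2.mul (Asymptotics.isBigO_refl (fun p : ℕ => ((p : ℝ) ^ 2)⁻¹) atTop)).congr' ?_ ?_
  · filter_upwards with p
    rw [div_eq_mul_inv]
  · filter_upwards [eventually_gt_atTop 0] with p hp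
    have hp' : (0 : ℝ) < p := by exact_mod_cast hp
    rw [← Real.rpow_natCast, ← Real.rpow_neg hp'.le, ← Real.rpow_add hp',
      one_div ((p : ℝ) ^ (3 / 2 : ℝ)), ← Real.rpow_neg hp'.le]
    norm_num

theorem summable_coeff_polylog_z {k : List ℕ+} (hk : Admissible k) :
    Summable fun p : ℕ => ((coeff p (polylog (H1.z k)) : ℚ) : ℝ) := by
  rcases List.eq_nil_or_concat k with rfl | ⟨k, a, rfl⟩
  · refine summable_of_ne_finset_zero (s := {0}) fun p hp => ?_
    rw [Finset.mem_singleton] at hp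
    simp [H1.z_nil, polylog_one, coeff_one, hp]
  · rw [List.concat_eq_append] at hk ⊢
    rw [admissible_concat] at hk
    refine Summable.of_nonneg_of_le (fun p => by exact_mod_cast coeff_polylog_z_nonneg _ p)
      (fun p => ?_) (summable_one_add_log_pow_div_sq k.length)
    rw [H1.z_concat, coeff_polylog_mul_letter_eq_truncZeta, div_eq_inv_mul]
    rcases Nat.eq_zero_or_pos p with rfl | hp
    · simp
    have hp1 : (1 : ℝ) ≤ p := by exact_mod_cast hp
    push_cast
    have h1 : (truncZeta p (H1.z k) : ℝ) ≤ (_root_.harmonic p : ℝ) ^ k.length := by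
      exact_mod_cast truncZeta_z_le k p
    have h2 : ((_root_.harmonic p : ℚ) : ℝ) ^ k.length ≤ (1 + Real.log p) ^ k.length :=
      pow_le_pow_left₀ (by exact_mod_cast (harmonic_pos hp.ne').le) (harmonic_le_one_add_log p) _
    refine mul_le_mul (inv_anti₀ (by positivity) (pow_le_pow_right₀ hp1 (by exact_mod_cast hk)))
      (h1.trans h2) (by exact_mod_cast truncZeta_z_nonneg k p) (by positivity)

/-- The multiple zeta series converges, and the truncated values are its partial sums over the
increasing tuples in a box. -/
theorem tendsto_truncZeta_z {k : List ℕ+} (hk : Admissible k) :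
    Tendsto (fun M => ((truncZeta M (H1.z k) : ℚ) : ℝ)) atTop (𝓝 (mzv k)) := by
  let P : (Fin k.length → ℕ) → Prop := fun n => StrictMono n ∧ ∀ j, 0 < n j
  let f : {n // P n} → ℝ := fun n => ∏ j, 1 / (n.1 j : ℝ) ^ (k.get j : ℕ)
  let s : ℕ → Finset {n // P n} := fun M => (increasing k.length M).subtype P
  have hs : ∀ M, 0 < M → ∑ n ∈ s M, f n = ((truncZeta M (H1.z k) : ℚ) : ℝ) := by
    intro M hM
    rw [truncZeta_z hM, Finset.sum_subtype_of_mem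
      (fun n : Fin k.length → ℕ => ∏ j, 1 / (n j : ℝ) ^ (k.get j : ℕ))
      fun n hn => (mem_increasing.mp hn).2]
    push_cast
    simp only [one_div]
  have hmono : Monotone s := by
    intro M N h n hn
    simp only [s, Finset.mem_subtype, mem_increasing] at hn ⊢
    exact ⟨fun j => (hn.1 j).trans_le h, hn.2⟩
  have hmem : ∀ n, ∃ M, n ∈ s M := by
    intro n
    refine ⟨Finset.univ.sup n.1 + 1, ?_⟩
    simp only [s, Finset.mem_subtype, mem_increasing]
    exact ⟨fun j => Nat.lt_succ_of_le (Finset.le_sup (Finset.mem_univ j)), n.2⟩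
  have htend := tendsto_atTop_finset_of_monotone hmono hmem
  have hf0 : ∀ n, 0 ≤ f n := fun n => Finset.prod_nonneg fun j _ => by positivity
  have hsum : Summable f := by
    refine summable_of_sum_le (c := ∑' p, ((coeff p (polylog (H1.z k)) : ℚ) : ℝ)) hf0 fun t => ?_
    obtain ⟨M, hM0, hM⟩ := ((eventually_gt_atTop 0).and
      (htend.eventually (eventually_ge_atTop t))).exists
    refine (Finset.sum_le_sum_of_subset_of_nonneg hM fun n _ _ => hf0 n).trans ?_
    rw [hs M hM0, truncZeta_apply]
    push_cast
    exact (summable_coeff_polylog_z hk).sum_le_tsum _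
      fun p _ => by exact_mod_cast coeff_polylog_z_nonneg k p
  refine (hsum.hasSum.comp htend).congr' ?_
  filter_upwards [eventually_gt_atTop 0] with M hM
  exact hs M hM

/-- For `u` in the kernel of `∂`, the power series `Li_u` converges absolutely at `1`, with value
`ζ(u)`. -/
theorem hasSum_coeff_polylog {u : H1} (hu : del u = 0) :
    HasSum (fun p : ℕ => ((coeff p (polylog u) : ℚ) : ℝ)) (zetaMap u) := by
  have hu' := mem_span_of_del_eq_zero hu
  clear hu
  induction hu' using Submodule.span_induction with
  | mem u hu =>
    obtain ⟨k, hk, rfl⟩ := hu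
    have h := (summable_coeff_polylog_z hk).hasSum
    convert h using 1
    rw [zetaMap_z]
    refine tendsto_nhds_unique (tendsto_truncZeta_z hk) (h.tendsto_sum_nat.congr fun M => ?_)
    rw [truncZeta_apply]
    push_cast
    rfl
  | zero => simp
  | add u v _ _ hu hv => simpa using hu.add hv
  | smul c u _ hu => simpa [Rat.smul_def] using hu.mul_left (c : ℝ)

theorem tendsto_truncZeta {u : H1} (hu : del u = 0) :
    Tendsto (fun M => ((truncZeta M u : ℚ) : ℝ)) atTop (𝓝 (zetaMap u)) := by
  refine (hasSum_coeff_polylog hu).tendsto_sum_nat.congr fun M => ?_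
  rw [truncZeta_apply]
  push_cast
  rfl

/-- `ζ` is multiplicative on the kernel of `∂`, for both products. -/
theorem zetaMap_mul (b : Reg) {u v : H1} (hu : del u = 0) (hv : del v = 0) :
    zetaMap (b.mul u v) = zetaMap u * zetaMap v := by
  have huv : del (b.mul u v) = 0 := by rw [b.del_mul, hu, hv]; simp
  cases b with
  | harmonic =>
    refine tendsto_nhds_unique (tendsto_truncZeta huv)
      (((tendsto_truncZeta hu).mul (tendsto_truncZeta hv)).congr fun M => ?_)
    rw [Reg.mul, truncZeta_harmonic]
    push_cast
    rfl
  | shuffle =>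
    have h1 := hasSum_coeff_polylog hu
    have h2 := hasSum_coeff_polylog hv
    rw [← h1.tsum_eq, ← h2.tsum_eq, ← (hasSum_coeff_polylog huv).tsum_eq,
      tsum_mul_tsum_eq_tsum_sum_antidiagonal_of_summable_norm h1.summable.norm h2.summable.norm]
    refine tsum_congr fun N => ?_
    rw [Reg.mul, polylog_shuffle, coeff_mul]
    push_cast
    rfl

theorem existsUnique_isRegularization (b : Reg) : ∃! Z, IsRegularization b Z := by
  obtain ⟨Z, hZ⟩ := exists_isRegularization b fun _ _ => zetaMap_mul b
  exact ⟨Z, hZ, fun Z' hZ' => hZ'.unique hZ⟩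

theorem isRegularization_regMap (b : Reg) : IsRegularization b (regMap b) := by
  have h := (existsUnique_isRegularization b).exists
  rw [regMap, dif_pos h]
  exact h.choose_spec

end Convergence

section Expansion

open PowerSeries

/-! ### The inner sums as elements of `𝔥¹` -/

/-- The positive integer `a + l`. -/
def shift (a : ℕ+) (l : ℕ) : ℕ+ := ⟨a + l, Nat.add_pos_left a.pos _⟩

theorem shift_coe (a : ℕ+) (l : ℕ) : (shift a l : ℕ) = a + l := rfl

/-- The element `∑_l b(k; l) z_{rev(k + l)}` of `𝔥¹`, where `l` runs over all tuples of weight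
`n`. -/
def shiftSum (k : List ℕ+) (n : ℕ) : H1 :=
  ∑ l ∈ Finset.piAntidiag (Finset.univ : Finset (Fin k.length)) n,
    (binom k l : ℚ) • H1.z (addIndex k l).reverse

theorem shiftSum_nil (n : ℕ) : shiftSum [] n = if n = 0 then 1 else 0 := by
  rw [shiftSum]
  rcases n with _ | n
  · simp [binom, addIndex, ← H1.z_nil]
    rfl
  · simp

/-- Sums over tuples of given weight, by the first entry. -/
theorem sum_piAntidiag_succ {N : Type*} [AddCommMonoid N] (r n : ℕ)
    (f : (Fin (r + 1) → ℕ) → N) :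
    ∑ l ∈ Finset.piAntidiag (Finset.univ : Finset (Fin (r + 1))) n, f l =
      ∑ x ∈ Finset.HasAntidiagonal.antidiagonal n,
        ∑ l ∈ Finset.piAntidiag (Finset.univ : Finset (Fin r)) x.2,
          f (Fin.cons (α := fun _ => ℕ) x.1 l) := by
  rw [Finset.sum_sigma']
  refine Finset.sum_nbij' (fun l => ⟨(l 0, ∑ j, Fin.tail l j), Fin.tail l⟩)
    (fun x => Fin.cons (α := fun _ => ℕ) x.1.1 x.2) ?_ ?_ (fun l _ => Fin.cons_self_tail l) ?_ ?_
  · intro l hl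
    simp only [Finset.mem_piAntidiag, Fin.sum_univ_succ] at hl
    simp [Fin.tail, hl.1]
    rfl
  · rintro ⟨⟨a, m⟩, l⟩ hx
    simp only [Finset.mem_sigma, Finset.HasAntidiagonal.mem_antidiagonal,
      Finset.mem_piAntidiag] at hx ⊢
    simp [Fin.sum_univ_succ, hx.2.1, hx.1]
  · rintro ⟨⟨a, m⟩, l⟩ hx
    simp only [Finset.mem_sigma, Finset.HasAntidiagonal.mem_antidiagonal,
      Finset.mem_piAntidiag] at hx
    simp [hx.2.1]
  · intro l _
    rw [Fin.cons_self_tail]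

theorem shiftSum_cons (a : ℕ+) (k : List ℕ+) (n : ℕ) :
    shiftSum (a :: k) n = ∑ x ∈ Finset.HasAntidiagonal.antidiagonal n,
      (((a : ℕ) + x.1 - 1).choose x.1 : ℚ) •
        (shiftSum k x.2 * FreeAlgebra.ι ℚ (shift a x.1)) := by
  rw [shiftSum]
  refine (sum_piAntidiag_succ k.length n _).trans (Finset.sum_congr rfl fun x _ => ?_)
  rw [shiftSum, Finset.sum_mul, Finset.smul_sum]
  refine Finset.sum_congr rfl fun l _ => ?_
  have h1 : addIndex (a :: k) (Fin.cons (α := fun _ => ℕ) x.1 l) =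
      shift a x.1 :: addIndex k l := by
    exact List.ofFn_succ
  have h2 : binom (a :: k) (Fin.cons (α := fun _ => ℕ) x.1 l) =
      ((a : ℕ) + x.1 - 1).choose x.1 * binom k l := by
    simp [binom, Fin.prod_univ_succ]
  rw [h1, h2, List.reverse_cons, H1.z_concat, smul_mul_assoc, smul_smul, Nat.cast_mul]

theorem del_shiftSum_nil (n : ℕ) : del (shiftSum [] n) = 0 := by
  rw [shiftSum_nil]; split_ifs <;> simp [del_one]

theorem del_shiftSum_cons (a : ℕ+) (k : List ℕ+) (n : ℕ) :
    del (shiftSum (a :: k) n) = if a = 1 then shiftSum k n else 0 := by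
  rw [shiftSum_cons, map_sum]
  simp only [map_smul, del_mul_letter]
  -- the letter `a + l` equals `1` only for `a = 1` and `l = 0`
  rw [Finset.sum_eq_single (0, n)]
  · have : shift a 0 = a := rfl
    simp [this]
  · rintro ⟨l, m⟩ hx hne
    rw [Finset.HasAntidiagonal.mem_antidiagonal] at hx
    have hl : l ≠ 0 := by
      rintro rfl
      exact hne (by simpa using hx)
    rw [if_neg, smul_zero]
    intro h
    have h1 := congrArg PNat.val h
    have h2 := a.pos
    change (a : ℕ) + l = 1 at h1
    omega
  · simp

/-- The element of `𝔥¹` whose truncated zeta value and whose zeta value are the coefficients of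
`t ^ n` in the truncated and in the regularized `t`-adic symmetric multiple zeta value. -/
def symElement (b : Reg) (k : List ℕ+) (n : ℕ) : H1 :=
  ∑ i ∈ Finset.range (k.length + 1),
    (-1 : ℚ) ^ wt (k.drop i) • b.mul (H1.z (k.take i)) (shiftSum (k.drop i) n)

theorem wt_cons (a : ℕ+) (k : List ℕ+) : wt (a :: k) = a + wt k := by simp [wt]

/-- By the Leibniz rule, `∂` of the sum defining `symElement` telescopes. -/
theorem del_symElement (b : Reg) (k : List ℕ+) (n : ℕ) : del (symElement b k n) = 0 := by
  -- `X i` comes from a trailing `1` of `k_[i]`; a leading `1` of `k^[i]` gives `-X (i + 1)`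
  let X : ℕ → H1 := fun i =>
    (-1 : ℚ) ^ wt (k.drop i) • b.mul (del (H1.z (k.take i))) (shiftSum (k.drop i) n)
  have h : ∀ i ∈ Finset.range (k.length + 1),
      del ((-1 : ℚ) ^ wt (k.drop i) • b.mul (H1.z (k.take i)) (shiftSum (k.drop i) n)) =
        X i - if i < k.length then X (i + 1) else 0 := by
    intro i _
    rw [map_smul, b.del_mul, smul_add, sub_eq_add_neg]
    congr 1
    split_ifs with hi
    · have h1 : k.drop i = k[i] :: k.drop (i + 1) := List.drop_eq_getElem_cons hi
      have h2 : k.take (i + 1) = k.take i ++ [k[i]] := (List.take_concat_get' k i hi).symm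
      simp only [X]
      rw [h1, del_shiftSum_cons, h2, H1.z_concat, del_mul_letter, wt_cons]
      split_ifs with ha
      · rw [ha, PNat.one_coe, pow_add, pow_one, neg_one_mul, neg_smul]
      · simp
    · rw [List.drop_eq_nil_of_le (not_lt.mp hi), del_shiftSum_nil]
      simp
  have h0 : X 0 = 0 := by simp [X, H1.z_nil, del_one]
  rw [symElement, map_sum, Finset.sum_congr rfl h, Finset.sum_sub_distrib,
    Finset.sum_range_succ', h0, add_zero, sub_eq_zero, Finset.sum_range_succ, if_neg (lt_irrefl _),
    add_zero]
  exact Finset.sum_congr rfl fun i hi => (if_pos (Finset.mem_range.mp hi)).symm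

/-! ### Expansion in `t` of the truncated sums -/

theorem nestedSum_map {R S : Type*} [CommRing R] [CommRing S] (f : R →+* S) (e : ℕ+ → ℕ → R)
    (k : List ℕ+) (p : ℕ) :
    nestedSum (fun a n => f (e a n)) k p = f (nestedSum e k p) := by
  induction k generalizing p with
  | nil => simp only [nestedSum]; split_ifs <;> simp
  | cons a k ih => simp only [nestedSum]; split_ifs <;> simp [ih]

/-- The binomial series `(-q + t)^(-a)`. -/
theorem coeff_inv_pow (a : ℕ+) {q : ℕ} (hq : 0 < q) (n : ℕ) :
    coeff n (((PowerSeries.C (-(q : ℚ)) + X) ^ (a : ℕ))⁻¹ : ℚ⟦X⟧) =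
      (-1) ^ (a : ℕ) * (((a : ℕ) + n - 1).choose n * ((q : ℚ) ^ ((a : ℕ) + n))⁻¹) := by
  have hq0 : (q : ℚ) ≠ 0 := by positivity
  obtain ⟨d, hd⟩ : ∃ d, (a : ℕ) = d + 1 := ⟨a - 1, by have := a.pos; omega⟩
  rw [hd]
  have hc : constantCoeff ((PowerSeries.C (-(q : ℚ)) + X) ^ (d + 1) : ℚ⟦X⟧) ≠ 0 := by
    simp [hq0]
  -- `-q + t = -q (1 - t / q)`
  have h1 : (PowerSeries.C (-(q : ℚ)) + X : ℚ⟦X⟧) =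
      PowerSeries.C (-(q : ℚ)) * rescale ((q : ℚ)⁻¹) (1 - X) := by
    rw [map_sub, map_one, rescale_X, mul_sub, ← mul_assoc, ← map_mul, neg_mul, mul_inv_cancel₀ hq0,
      mul_one, map_neg PowerSeries.C (1 : ℚ), map_one, neg_one_mul, sub_neg_eq_add]
  have h2 : (((PowerSeries.C (-(q : ℚ)) + X) ^ (d + 1))⁻¹ : ℚ⟦X⟧) =
      PowerSeries.C (((-(q : ℚ)) ^ (d + 1))⁻¹) *
        rescale ((q : ℚ)⁻¹) (mk fun n => ((d + n).choose d : ℚ)) := by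
    rw [inv_eq_iff_mul_eq_one hc, h1, mul_pow, ← map_pow, ← map_pow, mul_mul_mul_comm, ← map_mul,
      ← map_mul, mk_add_choose_mul_one_sub_pow_eq_one, map_one, mul_one, inv_mul_cancel₀, map_one]
    exact pow_ne_zero _ (neg_ne_zero.mpr hq0)
  rw [h2, coeff_C_mul, coeff_rescale, coeff_mk, show d + 1 + n - 1 = d + n by omega,
    Nat.choose_symm_add, neg_pow, mul_inv, pow_add _ (d + 1) n, mul_inv, inv_pow]
  have h3 : ((-1 : ℚ) ^ (d + 1))⁻¹ = (-1) ^ (d + 1) := by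
    rw [← inv_pow]; norm_num
  rw [h3]
  ring

/-- The coefficients in `t` of the sum `∑ 1 / ((-m₁ + t)^k₁ ⋯ (-m_r + t)^k_r)` over
`q = m₁ > ⋯ > m_r > 0`. -/
theorem coeff_nestedSum_neg (k : List ℕ+) (q n : ℕ) :
    coeff n (nestedSum (fun a m => ((PowerSeries.C (-(m : ℚ)) + X : ℚ⟦X⟧) ^ (a : ℕ))⁻¹) k q) =
      (-1) ^ wt k * coeff q (polylog (shiftSum k n)) := by
  induction k generalizing q n with
  | nil =>
    rw [nestedSum, shiftSum_nil]
    split_ifs with h1 h2 h2 <;> simp [polylog_one, coeff_one, wt, h1, h2]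
  | cons a k ih =>
    rw [nestedSum, shiftSum_cons]
    simp only [map_sum, map_smul, coeff_polylog_mul_letter]
    rcases Nat.eq_zero_or_pos q with rfl | hq
    · simp
    rw [if_neg hq.ne', coeff_mul, Finset.mul_sum]
    refine Finset.sum_congr rfl fun x _ => ?_
    rw [coeff_inv_pow a hq, map_sum, Finset.sum_congr rfl fun q' _ => ih q' x.2, ← Finset.mul_sum,
      wt_cons, pow_add, shift_coe, smul_eq_mul]
    ring

/-! ### Splitting a tuple into its positive and its negative entries -/

variable {i m : ℕ}

/-- The tuple `(u₁, …, u_i, -v_m, …, -v₁)`. -/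
def joinTuple (u : Fin i → ℕ) (v : Fin m → ℕ) : Fin (i + m) → ℤ :=
  Fin.append (fun j => (u j : ℤ)) fun j => -(v (Fin.rev j) : ℤ)

theorem joinTuple_castAdd (u : Fin i → ℕ) (v : Fin m → ℕ) (j : Fin i) :
    joinTuple u v (Fin.castAdd m j) = u j := Fin.append_left _ _ _

theorem joinTuple_natAdd (u : Fin i → ℕ) (v : Fin m → ℕ) (j : Fin m) :
    joinTuple u v (Fin.natAdd i j) = -(v (Fin.rev j) : ℤ) := Fin.append_right _ _ _

theorem joinTuple_injective {u u' : Fin i → ℕ} {v v' : Fin m → ℕ}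
    (h : joinTuple u v = joinTuple u' v') : u = u' ∧ v = v' := by
  constructor
  · funext j
    have := congrFun h (Fin.castAdd m j)
    simpa [joinTuple_castAdd] using this
  · funext j
    have := congrFun h (Fin.natAdd i (Fin.rev j))
    simpa [joinTuple_natAdd] using this

theorem isOrdered_joinTuple {u : Fin i → ℕ} {v : Fin m → ℕ} :
    IsOrdered i (joinTuple u v) ↔
      (StrictMono u ∧ ∀ j, 0 < u j) ∧ (StrictMono v ∧ ∀ j, 0 < v j) := by
  constructor
  · rintro ⟨hp, hn, hlt⟩
    refine ⟨⟨fun j j' h => ?_, fun j => ?_⟩, fun j j' h => ?_, fun j => ?_⟩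
    · have := hlt (Fin.castAdd m j) (Fin.castAdd m j') h (Or.inl j'.2)
      simpa [joinTuple_castAdd] using this
    · have := hp (Fin.castAdd m j) j.2
      simpa [joinTuple_castAdd] using this
    · have := hlt (Fin.natAdd i (Fin.rev j')) (Fin.natAdd i (Fin.rev j))
        (by simpa using h) (Or.inr (by simp))
      simpa [joinTuple_natAdd] using this
    · have := hn (Fin.natAdd i (Fin.rev j)) (by simp)
      simpa [joinTuple_natAdd] using this
  · rintro ⟨⟨hu, hu0⟩, hv, hv0⟩
    refine ⟨fun j hj => ?_, fun j hj => ?_, fun j j' h hjj => ?_⟩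
    · induction j using Fin.addCases with
      | left j => simpa [joinTuple_castAdd] using hu0 j
      | right j => simp at hj
    · induction j using Fin.addCases with
      | left j => exact absurd j.2 (not_lt.mpr hj)
      | right j => simpa [joinTuple_natAdd] using hv0 (Fin.rev j)
    · induction j using Fin.addCases with
      | left j =>
        induction j' using Fin.addCases with
        | left j' =>
          have := hu (show j < j' from h)
          simpa [joinTuple_castAdd] using this
        | right j' =>
          have := j.2
          simp at hjj
          omega
      | right j =>
        induction j' using Fin.addCases with
        | left j' =>
          have h' : i + (j : ℕ) < j' := h
          have := j'.2
          omega
        | right j' =>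
          have := hv (Fin.rev_lt_rev.mpr (show j < j' by simpa using h))
          simpa [joinTuple_natAdd] using this

theorem exists_eq_joinTuple {n : Fin (i + m) → ℤ} (hn : IsOrdered i n) :
    ∃ u v, joinTuple u v = n := by
  refine ⟨fun j => (n (Fin.castAdd m j)).toNat, fun j => (-n (Fin.natAdd i (Fin.rev j))).toNat, ?_⟩
  funext j
  induction j using Fin.addCases with
  | left j =>
    have := hn.1 (Fin.castAdd m j) j.2
    rw [joinTuple_castAdd]
    omega
  | right j =>
    have := hn.2.1 (Fin.natAdd i j) (by simp)
    rw [joinTuple_natAdd, Fin.rev_rev]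
    omega

/-- The largest entries of `u` and `v` are `n_i` and `-n_{i+1}` for the joined tuple `n`. -/
theorem isTruncated_joinTuple {u : Fin i → ℕ} {v : Fin m → ℕ} (hu : StrictMono u)
    (hv : StrictMono v) (M : ℕ) (b : Reg) :
    ((∀ j, -(M : ℤ) < joinTuple u v j ∧ joinTuple u v j < M) ∧ IsTruncated M i (joinTuple u v) b) ↔
      (∀ j, u j < M) ∧ (∀ j, v j < M) ∧
        PairTruncated M (Finset.univ.sup u) (Finset.univ.sup v) b := by
  have hbox : (∀ j, -(M : ℤ) < joinTuple u v j ∧ joinTuple u v j < M) ↔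
      (∀ j, u j < M) ∧ (∀ j, v j < M) := by
    constructor
    · refine fun h => ⟨fun j => ?_, fun j => ?_⟩
      · have := (h (Fin.castAdd m j)).2
        rw [joinTuple_castAdd] at this
        omega
      · have := (h (Fin.natAdd i (Fin.rev j))).1
        rw [joinTuple_natAdd, Fin.rev_rev] at this
        omega
    · rintro ⟨h1, h2⟩ j
      induction j using Fin.addCases with
      | left j =>
        have := h1 j
        rw [joinTuple_castAdd]
        omega
      | right j =>
        have := h2 (Fin.rev j)
        rw [joinTuple_natAdd]
        omega
  rw [← and_assoc, ← hbox]
  refine and_congr_right fun h => ?_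
  cases b with
  | harmonic => exact iff_of_true h trivial
  | shuffle =>
    have e1 : (if h : 0 < i ∧ i ≤ i + m then joinTuple u v ⟨i - 1, by omega⟩ else 0) =
        ((Finset.univ.sup u : ℕ) : ℤ) := by
      rcases i with _ | i
      · simp
      · rw [dif_pos ⟨by omega, by omega⟩, sup_eq_last hu]
        exact joinTuple_castAdd u v (Fin.last i)
    have e2 : (if h : i < i + m then joinTuple u v ⟨i, h⟩ else 0) =
        -((Finset.univ.sup v : ℕ) : ℤ) := by
      rcases m with _ | m
      · simp
      · rw [dif_pos (by omega), sup_eq_last hv, ← Fin.rev_zero]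
        exact joinTuple_natAdd u v 0
    rw [IsTruncated, e1, e2, PairTruncated]
    omega

open Classical in
/-- The tuples contributing to the truncated sum are the pairs of increasing tuples of positive
integers, subject to the truncation condition. -/
theorem sum_isOrdered {R : Type*} [CommRing R] (b : Reg) (M : ℕ) (f : (Fin (i + m) → ℤ) → R) :
    (∑ n ∈ Fintype.piFinset (fun _ : Fin (i + m) => Finset.Ioo (-(M : ℤ)) (M : ℤ)) with
        IsOrdered i n ∧ IsTruncated M i n b, f n) =
      ∑ u ∈ increasing i M, ∑ v ∈ increasing m M,
        if PairTruncated M (Finset.univ.sup u) (Finset.univ.sup v) b then f (joinTuple u v)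
        else 0 := by
  rw [← Finset.sum_product', ← Finset.sum_filter]
  have hmem : ∀ (u : Fin i → ℕ) (v : Fin m → ℕ), joinTuple u v ∈
      (Fintype.piFinset (fun _ : Fin (i + m) => Finset.Ioo (-(M : ℤ)) (M : ℤ))).filter
        (fun n => IsOrdered i n ∧ IsTruncated M i n b) ↔
      (u ∈ increasing i M ∧ v ∈ increasing m M) ∧
        PairTruncated M (Finset.univ.sup u) (Finset.univ.sup v) b := by
    intro u v
    rw [Finset.mem_filter, Fintype.mem_piFinset, mem_increasing, mem_increasing]
    simp only [Finset.mem_Ioo]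
    constructor
    · rintro ⟨h1, h2, h3⟩
      have ho := isOrdered_joinTuple.mp h2
      have ht := (isTruncated_joinTuple ho.1.1 ho.2.1 M b).mp ⟨h1, h3⟩
      exact ⟨⟨⟨ht.1, ho.1⟩, ht.2.1, ho.2⟩, ht.2.2⟩
    · rintro ⟨⟨⟨h1, h2⟩, h3, h4⟩, h5⟩
      have ht := (isTruncated_joinTuple h2.1 h4.1 M b).mpr ⟨h1, h3, h5⟩
      exact ⟨ht.1, isOrdered_joinTuple.mpr ⟨h2, h4⟩, ht.2⟩
  symm
  refine Finset.sum_nbij (fun x => joinTuple x.1 x.2) ?_ ?_ ?_ fun _ _ => rfl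
  · rintro ⟨u, v⟩ hx
    rw [Finset.mem_filter, Finset.mem_product] at hx
    exact (hmem u v).mpr hx
  · rintro ⟨u, v⟩ _ ⟨u', v'⟩ _ h
    obtain ⟨rfl, rfl⟩ := joinTuple_injective h
    rfl
  · intro n hn
    obtain ⟨u, v, rfl⟩ := exists_eq_joinTuple (Finset.mem_filter.mp hn).2.1
    refine ⟨(u, v), ?_, rfl⟩
    rw [Finset.mem_coe, Finset.mem_filter, Finset.mem_product]
    exact (hmem u v).mp hn

theorem reverse_ofFn_rev {α : Type*} (f : Fin m → α) :
    (List.ofFn fun j => f (Fin.rev j)).reverse = List.ofFn f := by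
  refine List.ext_getElem (by simp) fun j h1 h2 => ?_
  simp only [List.length_ofFn] at h2
  simp only [List.getElem_reverse, List.getElem_ofFn, List.length_ofFn]
  congr 1
  ext
  simp
  omega

open Classical in
/-- The sum over the tuples with `i` positive and `m` negative entries, in terms of nested sums. -/
theorem sum_isOrdered_prod (b : Reg) {M : ℕ} (hM : 0 < M) (κ : Fin (i + m) → ℕ+) :
    (∑ n ∈ Fintype.piFinset (fun _ : Fin (i + m) => Finset.Ioo (-(M : ℤ)) (M : ℤ)) with
        IsOrdered i n ∧ IsTruncated M i n b,
      ∏ j : Fin (i + m),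
        if (j : ℕ) < i then (PowerSeries.C ((n j : ℚ) ^ (κ j : ℕ)))⁻¹
        else ((PowerSeries.C (n j : ℚ) + PowerSeries.X) ^ (κ j : ℕ))⁻¹) =
      ∑ p ∈ Finset.range M, ∑ q ∈ Finset.range M, if PairTruncated M p q b then
        PowerSeries.C (coeff p (polylog (H1.z ((List.ofFn κ).take i)))) *
          nestedSum (fun a m => ((PowerSeries.C (-(m : ℚ)) + X : ℚ⟦X⟧) ^ (a : ℕ))⁻¹)
            ((List.ofFn κ).drop i) q else 0 := by
  rw [sum_isOrdered]
  let e₁ : ℕ+ → ℕ → ℚ⟦X⟧ := fun a n => PowerSeries.C (((n : ℚ) ^ (a : ℕ))⁻¹)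
  let e₂ : ℕ+ → ℕ → ℚ⟦X⟧ := fun a n => ((PowerSeries.C (-(n : ℚ)) + X : ℚ⟦X⟧) ^ (a : ℕ))⁻¹
  have hprod : ∀ (u : Fin i → ℕ) (v : Fin m → ℕ), (∏ j : Fin (i + m),
      if (j : ℕ) < i then (PowerSeries.C ((joinTuple u v j : ℚ) ^ (κ j : ℕ)))⁻¹
        else ((PowerSeries.C (joinTuple u v j : ℚ) + PowerSeries.X) ^ (κ j : ℕ))⁻¹) =
      (∏ j, e₁ (κ (Fin.castAdd m j)) (u j)) *
        ∏ j, e₂ (κ (Fin.natAdd i (Fin.rev j))) (v j) := by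
    intro u v
    rw [Fin.prod_univ_add]
    congr 1
    · refine Finset.prod_congr rfl fun j _ => ?_
      rw [if_pos (by simp), joinTuple_castAdd, PowerSeries.C_inv]
      simp [e₁]
    · rw [← Equiv.prod_comp Fin.revPerm]
      refine Finset.prod_congr rfl fun j _ => ?_
      rw [if_neg (by simp), joinTuple_natAdd]
      simp [e₂]
  have hlist : List.ofFn κ = (List.ofFn fun j => κ (Fin.castAdd m j)) ++
      List.ofFn fun j => κ (Fin.natAdd i j) := List.ofFn_add
  have htake : (List.ofFn κ).take i = List.ofFn fun j => κ (Fin.castAdd m j) := by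
    rw [hlist, List.take_left' (by simp)]
  have hdrop : (List.ofFn κ).drop i = List.ofFn fun j => κ (Fin.natAdd i j) := by
    rw [hlist, List.drop_left' (by simp)]
  have hinner : ∀ p, ∑ v ∈ increasing m M, (∏ j, e₂ (κ (Fin.natAdd i (Fin.rev j))) (v j)) *
      (if PairTruncated M p (Finset.univ.sup v) b then 1 else 0) =
      ∑ q ∈ Finset.range M, nestedSum e₂ ((List.ofFn κ).drop i) q *
        (if PairTruncated M p q b then 1 else 0) := by
    intro p
    rw [sum_increasing e₂ hM (fun j => κ (Fin.natAdd i (Fin.rev j)))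
      (fun q => if PairTruncated M p q b then 1 else 0), hdrop,
      reverse_ofFn_rev fun j => κ (Fin.natAdd i j)]
  have houter := sum_increasing e₁ hM (fun j => κ (Fin.castAdd m j)) fun p =>
    ∑ q ∈ Finset.range M, nestedSum e₂ ((List.ofFn κ).drop i) q *
        (if PairTruncated M p q b then 1 else 0)
  have hnested : ∀ p, nestedSum e₁ (List.ofFn fun j => κ (Fin.castAdd m j)).reverse p =
      PowerSeries.C (coeff p (polylog (H1.z ((List.ofFn κ).take i)))) := by
    intro p
    rw [htake, coeff_polylog_z]
    exact nestedSum_map (R := ℚ) (S := ℚ⟦X⟧) PowerSeries.C _ _ _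
  trans ∑ u ∈ increasing i M, (∏ j, e₁ (κ (Fin.castAdd m j)) (u j)) *
      ∑ q ∈ Finset.range M, nestedSum e₂ ((List.ofFn κ).drop i) q *
        (if PairTruncated M (Finset.univ.sup u) q b then 1 else 0)
  · refine Finset.sum_congr rfl fun u _ => ?_
    rw [← hinner, Finset.mul_sum]
    refine Finset.sum_congr rfl fun v _ => ?_
    rw [hprod]
    split_ifs <;> ring
  · rw [houter]
    refine Finset.sum_congr rfl fun p _ => ?_
    rw [hnested, Finset.mul_sum]
    refine Finset.sum_congr rfl fun q _ => ?_
    split_ifs <;> ring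

open Classical in
/-- The coefficients of the truncated symmetric multiple zeta value as truncated zeta values. -/
theorem coeff_truncSymMZV (b : Reg) {M : ℕ} (hM : 0 < M) (k : List ℕ+) (n : ℕ) :
    coeff n (truncSymMZV b M k) = truncZeta M (symElement b k n) := by
  rw [truncSymMZV, symElement, map_sum, map_sum]
  refine Finset.sum_congr rfl fun i hi => ?_
  obtain ⟨m, hm⟩ : ∃ m, k.length = i + m :=
    Nat.exists_eq_add_of_le (Nat.lt_succ_iff.mp (Finset.mem_range.mp hi))
  -- transport the sum from `Fin k.length` to `Fin (i + m)`
  have key : ∀ (r : ℕ) (κ : Fin r → ℕ+), r = i + m →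
      (∑ n ∈ Fintype.piFinset (fun _ : Fin r => Finset.Ioo (-(M : ℤ)) (M : ℤ)) with
        IsOrdered i n ∧ IsTruncated M i n b,
      ∏ j : Fin r,
        if (j : ℕ) < i then (PowerSeries.C ((n j : ℚ) ^ (κ j : ℕ)))⁻¹
        else ((PowerSeries.C (n j : ℚ) + PowerSeries.X) ^ (κ j : ℕ))⁻¹) =
      ∑ p ∈ Finset.range M, ∑ q ∈ Finset.range M, if PairTruncated M p q b then
        PowerSeries.C (coeff p (polylog (H1.z ((List.ofFn κ).take i)))) *
          nestedSum (fun a m => ((PowerSeries.C (-(m : ℚ)) + X : ℚ⟦X⟧) ^ (a : ℕ))⁻¹)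
            ((List.ofFn κ).drop i) q else 0 := by
    rintro r κ rfl
    exact sum_isOrdered_prod b hM κ
  rw [key k.length k.get hm, List.ofFn_get, map_smul, truncZeta_mul, smul_eq_mul, map_sum,
    Finset.mul_sum]
  refine Finset.sum_congr rfl fun p _ => ?_
  rw [map_sum, Finset.mul_sum]
  refine Finset.sum_congr rfl fun q _ => ?_
  split_ifs
  · rw [coeff_C_mul, coeff_nestedSum_neg]
    ring
  · simp

/-! ### The regularized values and the limit -/

/-- The constant term of `Z^•`. -/
def regMapConst (b : Reg) : H1 →ₗ[ℚ] ℝ :=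
  ((Polynomial.aeval (0 : ℝ)).restrictScalars ℚ).toLinearMap ∘ₗ regMap b

theorem regMapConst_apply (b : Reg) (u : H1) : regMapConst b u = (regMap b u).eval 0 := by
  simp [regMapConst, Polynomial.coe_aeval_eq_eval]

theorem regMapConst_mul (b : Reg) (u v : H1) :
    regMapConst b (b.mul u v) = regMapConst b u * regMapConst b v := by
  simp only [regMapConst_apply, (isRegularization_regMap b).map_mul, Polynomial.eval_mul]

/-- Since `Z^•(V)` is constant for `V = symElement b k n`, its value is `ζ(V)`; expanding `Z^•(V)`
by multiplicativity gives the coefficient of the symmetric multiple zeta value. -/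
theorem coeff_symMZV (b : Reg) (k : List ℕ+) (n : ℕ) :
    coeff n (symMZV b k) = zetaMap (symElement b k n) := by
  have h : zetaMap (symElement b k n) = regMapConst b (symElement b k n) := by
    rw [regMapConst_apply, (isRegularization_regMap b).map_of_del_eq_zero (del_symElement b k n),
      Polynomial.eval_C]
  rw [h, symMZV, symElement, map_sum, map_sum]
  refine Finset.sum_congr rfl fun i _ => ?_
  rw [coeff_C_mul, coeff_mk, map_smul, regMapConst_mul, shiftSum, map_sum, Rat.smul_def, regMZV,
    ← regMapConst_apply]
  push_cast
  rw [mul_assoc]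
  congr 2
  refine Finset.sum_congr rfl fun l _ => ?_
  rw [map_smul, Rat.smul_def, Rat.cast_natCast, regMZV, regMapConst_apply]

end Expansion

end TAdicSMZV

end

theorem theorem1p2 (b : TAdicSMZV.Reg) (k : List ℕ+) :
    (∃! Z : TAdicSMZV.H1 →ₗ[ℚ] Polynomial ℝ, TAdicSMZV.IsRegularization b Z) ∧
    ∀ n : ℕ, Filter.Tendsto
      (fun M : ℕ => ((PowerSeries.coeff n (TAdicSMZV.truncSymMZV b M k) : ℚ) : ℝ))
      Filter.atTop (nhds (PowerSeries.coeff n (TAdicSMZV.symMZV b k))) := by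
  refine ⟨TAdicSMZV.existsUnique_isRegularization b, fun n => ?_⟩
  rw [TAdicSMZV.coeff_symMZV]
  refine (TAdicSMZV.tendsto_truncZeta (TAdicSMZV.del_symElement b k n)).congr' ?_
  filter_upwards [Filter.eventually_gt_atTop 0] with M hM
  rw [TAdicSMZV.coeff_truncSymMZV b hM]
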